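/- Let $m,n,k\ge 1$ be integers with $k\le\min(m,n)$. Assign independent exponentially distributed costs of mean $1$ to the $mn$ edges of the complete bipartite graph $K_{m,n}$, and let $C_{k,m,n}$ be the minimum total cost of a $k$-matching, that is, of a set of $k$ edges no two of which share a vertex. The moment generating function $F_{k,m,n}(t)=\mathbb{E}[\exp(t\,C_{k,m,n})]$ of the complex variable $t$ is, wherever this expectation converges, equal to a rational function of $t$ without a pole there; denote this rational function on all of $\mathbb{C}$ again by $F_{k,m,n}$. Then for each fixed $k\ge 1$ there are only finitely many pairs of integers $m,n\ge k$ for which $F_{k,m,n}$ has a zero in the closed disk $\{t\in\mathbb{C}: |t|\le mn/k\}$. -/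

import Mathlib

namespace BipartiteMatching

open MeasureTheory ProbabilityTheory

/-- A `k`-matching of the complete bipartite graph `K_{m,n}`, whose edges are the pairs in
`Fin m × Fin n`: a set of `k` edges, no two of which have a vertex in common. -/
def IsKMatching (k m n : ℕ) (M : Finset (Fin m × Fin n)) : Prop :=
  M.card = k ∧ ∀ e ∈ M, ∀ f ∈ M, e ≠ f → e.1 ≠ f.1 ∧ e.2 ≠ f.2

/-- `C_{k,m,n}`: the minimum total cost of a `k`-matching for the edge costs `c`
(an infimum over a finite family, which is nonempty if `k ≤ m` and `k ≤ n`). -/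
noncomputable def minCost (k m n : ℕ) (c : Fin m × Fin n → ℝ) : ℝ :=
  ⨅ M : {M : Finset (Fin m × Fin n) // IsKMatching k m n M}, ∑ e ∈ M.1, c e

/-- The law of the edge costs: independent exponential variables of mean `1`. -/
noncomputable def costMeasure (m n : ℕ) : Measure (Fin m × Fin n → ℝ) :=
  Measure.pi fun _ => expMeasure 1

/-- The rational function `F` is the moment generating function of `C_{k,m,n}`, continued
meromorphically to the complex plane: wherever the expectation `𝔼 [exp (t * C_{k,m,n})]` of the
complex variable `t` converges, `F` has no pole at `t` and takes that value. The expectation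
converges at least for `t.re ≤ 0`, so `F` is determined by this. -/
def IsMomentGeneratingFunction (k m n : ℕ) (F : RatFunc ℂ) : Prop :=
  ∀ t : ℂ, Integrable (fun c => Complex.exp (t * (minCost k m n c : ℂ))) (costMeasure m n) →
    F.denom.eval t ≠ 0 ∧
      F.eval (RingHom.id ℂ) t = complexMGF (minCost k m n) (costMeasure m n) t

/-- `t` is a zero of the rational function `F` (numerator and denominator are in lowest terms). -/
def IsZeroOf (F : RatFunc ℂ) (t : ℂ) : Prop :=
  F.num.eval t = 0

end BipartiteMatching

open MeasureTheory ProbabilityTheory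
open scoped ENNReal

namespace BipartiteMatching

/-! Let `C` be the minimum cost and ρ = mn/k. The main tool is memorylessness of the exponential
law. If every admissible set has exactly q elements in A, splitting off the minimum over A gives E
exp(tC) = (|A| - qt)⁻¹ ∑_{e ∈ A} E exp(tC_e), where C_e is the minimum after the cost of e is set to
0 (`integral_expPi_extract`).

Let k < m and let n be large. Take A to be the set of all edges; the prefactor has no zero, so only
the sum matters. With a zero at e, the minimum lies between two quantities: `rowMin`, which ignores
the column condition, and the cost of a (k-1)-matching avoiding the vertices of e. The first has an
explicit product as moment generating function (`integral_cexp_rowMin`). The second is bounded, at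
real arguments, by a similar product (`lintegral_exp_minCost_le`). At ρ the two products approach
each other as n → ∞, uniformly in m. Since exp has nonnegative Taylor coefficients, the real
difference at ρ bounds the complex difference on the whole disk (`norm_cexp_sub_cexp_le`), while the
product for `rowMin` stays at least 2^(1-k) in norm there.

For k = m the factors of that product degenerate at ρ = n. Instead the minimum of each row is split
off (`sum_integral_zeroRows`). This leaves (n/(n-t))^k times an average over all choices of one zero
per row. If the zeros lie in different columns the cost is 0 and the expectation is 1. The other
choices have proportion at most k²/n, and each changes the expectation by a bounded amount, so the
average is nonzero for large n.

Transposition covers large m, so only finitely many pairs remain. The point t = ρ is treated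
separately: the function is at least 1 on (0, ρ), so by continuity it cannot vanish at ρ.
Rationality holds because shears cut the orthant into pieces on which a minimum of linear forms is a
single form (`rationalIntegral`). -/

/-! ### Cutting the orthant into sheared copies of itself -/

/-- Lebesgue measure on the open positive orthant. -/
noncomputable def orthantMeasure (ι : Type*) [Fintype ι] : Measure (ι → ℝ) :=
  Measure.pi fun _ => volume.restrict (Set.Ioi 0)

/-- The coordinates in `A` other than `e` are increased proportionally to the coordinate at `e`. -/
noncomputable def shear {ι : Type*} [DecidableEq ι] (A : Finset ι) (a : ι → ℝ) (e : ι)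
    (x : ι → ℝ) : ι → ℝ :=
  fun f => x f + x e * (if f ∈ A ∧ f ≠ e then a f / a e else 0)

section Orthant

variable {ι : Type*} [Fintype ι]

/-- The map is the identity plus a matrix of rank one, so its determinant is `1 + u e = 1`. -/
lemma measurePreserving_add_smul [DecidableEq ι] (e : ι) (u : ι → ℝ) (hu : u e = 0) :
    MeasurePreserving (fun x : ι → ℝ => fun f => x f + x e * u f) volume volume := by
  have hdet : (1 + Matrix.replicateCol Unit u *
      Matrix.replicateRow Unit (Pi.single e (1 : ℝ))).det = 1 := by
    rw [Matrix.det_one_add_replicateCol_mul_replicateRow]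
    simp [hu]
  have hmap := Real.map_matrix_volume_pi_eq_smul_volume_pi (M := 1 + Matrix.replicateCol Unit u *
      Matrix.replicateRow Unit (Pi.single e (1 : ℝ))) (by rw [hdet]; exact one_ne_zero)
  have hfun : ⇑(Matrix.toLin' (1 + Matrix.replicateCol Unit u *
      Matrix.replicateRow Unit (Pi.single e (1 : ℝ)))) =
      (fun x : ι → ℝ => fun f => x f + x e * u f) := by
    ext x f
    simp only [Matrix.toLin'_apply, Matrix.add_mulVec, Matrix.one_mulVec, Pi.add_apply,
      ← Matrix.mulVec_mulVec]
    have : ∑ i, x i * (Pi.single e (1 : ℝ) : ι → ℝ) i = x e := by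
      simp [Pi.single_apply]
    simp [Matrix.mulVec, dotProduct, mul_comm, this]
  rw [hdet, hfun] at hmap
  refine ⟨by fun_prop, ?_⟩
  simpa using hmap

lemma measurable_shear {ι : Type*} [DecidableEq ι] (A : Finset ι) (a : ι → ℝ) (e : ι) : Measurable (shear A a e) := by
  unfold shear; fun_prop

lemma measurePreserving_shear [DecidableEq ι] (A : Finset ι) (a : ι → ℝ) (e : ι) :
    MeasurePreserving (shear A a e) volume volume :=
  measurePreserving_add_smul e (fun f => if f ∈ A ∧ f ≠ e then a f / a e else 0) (by simp)

lemma orthantMeasure_eq_restrict :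
    orthantMeasure ι = volume.restrict {x : ι → ℝ | ∀ i, 0 < x i} := by
  have : {x : ι → ℝ | ∀ i, 0 < x i} = Set.univ.pi fun _ => Set.Ioi 0 := by
    ext x; simp
  rw [this, volume_pi, Measure.restrict_pi_pi, orthantMeasure]

lemma ae_orthantMeasure_pos : ∀ᵐ x ∂(orthantMeasure ι), ∀ i, 0 < x i := by
  rw [orthantMeasure_eq_restrict]
  have h : MeasurableSet {x : ι → ℝ | ∀ i, 0 < x i} := by
    have : {x : ι → ℝ | ∀ i, 0 < x i} = ⋂ i, {x | 0 < x i} := by ext x; simp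
    rw [this]
    exact MeasurableSet.iInter fun i => measurableSet_lt measurable_const (measurable_pi_apply i)
  exact ae_restrict_mem h

/-- The set of ties is a linear subspace, and a proper one since it omits the unit vector at `e`. -/
lemma volume_div_eq_div [DecidableEq ι] (a : ι → ℝ) (ha : ∀ i, 0 < a i) {e f : ι} (h : e ≠ f) :
    volume {x : ι → ℝ | x e / a e = x f / a f} = 0 := by
  let s : Submodule ℝ (ι → ℝ) :=
    { carrier := {x : ι → ℝ | x e / a e = x f / a f}
      add_mem' := by
        intro x y hx hy
        simp only [Set.mem_ofPred_eq, Pi.add_apply, add_div] at *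
        rw [hx, hy]
      zero_mem' := by simp
      smul_mem' := by
        intro c x hx
        simp only [Set.mem_ofPred_eq, Pi.smul_apply, smul_eq_mul, mul_div_assoc] at *
        rw [hx] }
  refine Measure.addHaar_submodule volume s fun hs => ?_
  have : Pi.single e (1 : ℝ) ∈ s := hs ▸ Submodule.mem_top
  have h1 : (Pi.single e (1 : ℝ) : ι → ℝ) e / a e = (Pi.single e (1 : ℝ) : ι → ℝ) f / a f := this
  rw [Pi.single_eq_same, Pi.single_eq_of_ne h.symm] at h1
  have := ha e
  simp at h1
  exact this.ne' h1

/-- The orthant is cut up according to the coordinate in `A` at which `x e / a e` is smallest. -/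
theorem orthantMeasure_eq_sum_shear [DecidableEq ι] (A : Finset ι) (hA : A.Nonempty) (a : ι → ℝ)
    (ha : ∀ i, 0 < a i) :
    orthantMeasure ι = ∑ e ∈ A, (orthantMeasure ι).map (shear A a e) := by
  set O : Set (ι → ℝ) := {x | ∀ i, 0 < x i} with hO
  let R : ι → Set (ι → ℝ) := fun e => {x | (∀ i, 0 < x i) ∧
    ∀ f ∈ A, f ≠ e → x e / a e < x f / a f}
  have hR : ∀ e, MeasurableSet (R e) := by
    intro e
    have : R e = (⋂ i, {x | 0 < x i}) ∩ ⋂ f ∈ A, ⋂ (_ : f ≠ e), {x | x e / a e < x f / a f} := by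
      ext x; simp [R]
    rw [this]
    refine (MeasurableSet.iInter fun i =>
      measurableSet_lt measurable_const (measurable_pi_apply i)).inter ?_
    refine Finset.measurableSet_biInter _ fun f _ => MeasurableSet.iInter fun _ => ?_
    exact measurableSet_lt (by fun_prop) (by fun_prop)
  -- The shear adds `x e / a e` to every other ratio `x f / a f` with `f ∈ A`; positivity of the old
  -- ratio is the strict inequality between the new ones.
  have hpre : ∀ e ∈ A, shear A a e ⁻¹' R e = O := by
    intro e he
    ext x
    have hval : ∀ f ∈ A, f ≠ e → shear A a e x f / a f = x f / a f + x e / a e := by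
      intro f hf hfe
      have := (ha f).ne'
      have := (ha e).ne'
      simp only [shear, hf, hfe, ne_eq, not_false_eq_true, and_self, if_true]
      field_simp
    have hself : shear A a e x e = x e := by simp [shear]
    simp only [Set.mem_preimage, R, Set.mem_ofPred_eq, hO]
    constructor
    · rintro ⟨h1, h2⟩ i
      by_cases hi : i ∈ A ∧ i ≠ e
      · have h3 := h2 i hi.1 hi.2
        rw [hval i hi.1 hi.2, hself] at h3
        have h4 : 0 < x i / a i := by linarith
        exact (div_pos_iff_of_pos_right (ha i)).1 h4
      · have := h1 i
        simpa [shear, hi] using this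
    · intro h
      refine ⟨fun i => ?_, fun f hf hfe => ?_⟩
      · unfold shear
        refine add_pos_of_pos_of_nonneg (h i) (mul_nonneg (h e).le ?_)
        split_ifs
        · exact div_nonneg (ha i).le (ha e).le
        · exact le_rfl
      · rw [hval f hf hfe, hself]
        have : 0 < x f / a f := div_pos (h f) (ha f)
        linarith
  have hmap : ∀ e ∈ A, (orthantMeasure ι).map (shear A a e) = volume.restrict (R e) := by
    intro e he
    rw [orthantMeasure_eq_restrict, ← hO, ← hpre e he]
    exact ((measurePreserving_shear A a e).restrict_preimage (hR e)).map_eq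
  rw [Finset.sum_congr rfl hmap]
  have hdisj : Set.PairwiseDisjoint (↑A) R := by
    intro e he f hf hef
    refine Set.disjoint_left.2 fun x hx hy => ?_
    have h1 := hx.2 f hf hef.symm
    have h2 := hy.2 e he hef
    exact lt_asymm h1 h2
  have hU : volume.restrict (⋃ e ∈ A, R e) = ∑ e ∈ A, volume.restrict (R e) := by
    ext s hs
    rw [Measure.finsetSum_apply, Measure.restrict_apply hs, Set.inter_iUnion₂,
      measure_biUnion_finset]
    · exact Finset.sum_congr rfl fun e _ => (Measure.restrict_apply hs).symm
    · exact fun e he f hf hef => (hdisj he hf hef).mono Set.inter_subset_right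
        Set.inter_subset_right
    · exact fun e _ => hs.inter (hR e)
  rw [← hU, orthantMeasure_eq_restrict]
  refine Measure.restrict_congr_set ?_
  -- The cells `R e` have strict inequalities, so they miss only points with ties, which form a null
  -- set.
  have hties : ∀ᵐ x : ι → ℝ, ∀ e f, e ≠ f → x e / a e ≠ x f / a f := by
    rw [ae_all_iff]; intro e
    rw [ae_all_iff]; intro f
    by_cases h : e = f
    · simp [h]
    · have h0 := volume_div_eq_div a ha h
      have : ∀ᵐ x : ι → ℝ, x e / a e ≠ x f / a f := by
        rw [ae_iff]; simpa using h0
      filter_upwards [this] with x hx _ using hx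
  filter_upwards [hties] with x hx
  refine propext ⟨fun h => ?_, fun h => ?_⟩
  · obtain ⟨e, he, hmin⟩ := A.exists_min_image (fun e => x e / a e) hA
    exact Set.mem_biUnion (show e ∈ (↑A : Set ι) from he)
      ⟨h, fun f hf hfe => lt_of_le_of_ne (hmin f hf) (hx e f hfe.symm)⟩
  · obtain ⟨e, _, he⟩ := Set.mem_iUnion₂.1 h
    exact he.1

end Orthant

/-! ### Exponential laws and splitting off a minimum -/

/-- The law of independent exponential variables of mean `1`, indexed by `ι`. -/
noncomputable def expPi (ι : Type*) [Fintype ι] : Measure (ι → ℝ) :=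
  Measure.pi fun _ => expMeasure 1

lemma costMeasure_eq (m n : ℕ) : costMeasure m n = expPi (Fin m × Fin n) := rfl

section Exponential

instance : IsProbabilityMeasure (expMeasure 1) := isProbabilityMeasure_expMeasure one_pos

variable {ι : Type*} [Fintype ι]

instance : IsProbabilityMeasure (expPi ι) := by unfold expPi; infer_instance

instance : SigmaFinite (orthantMeasure ι) := by unfold orthantMeasure; infer_instance

lemma expMeasure_eq_withDensity :
    expMeasure 1 = (volume.restrict (Set.Ioi 0)).withDensity
      fun x => ENNReal.ofReal (Real.exp (-x)) := by
  have h : exponentialPDF 1 =ᵐ[volume]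
      (Set.Ioi (0 : ℝ)).indicator fun x => ENNReal.ofReal (Real.exp (-x)) := by
    have h0 : ∀ᵐ x : ℝ, x ≠ 0 := by simp [ae_iff]
    filter_upwards [h0] with x hx
    rcases lt_or_gt_of_ne hx with h | h
    · rw [exponentialPDF_of_neg h, Set.indicator_of_notMem (by simp [h.le])]
    · rw [exponentialPDF_of_nonneg h.le, Set.indicator_of_mem (by simpa using h)]
      simp
  have h2 : expMeasure 1 = volume.withDensity (exponentialPDF 1) := rfl
  rw [h2, withDensity_congr_ae h, withDensity_indicator measurableSet_Ioi]

/-- Expressing Lebesgue measure through a probability measure makes product formulas for independent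
variables available on the orthant. -/
lemma restrict_Ioi_eq_withDensity :
    volume.restrict (Set.Ioi (0 : ℝ)) =
      (expMeasure 1).withDensity fun x => ENNReal.ofReal (Real.exp x) := by
  rw [expMeasure_eq_withDensity, ← withDensity_mul _ (by fun_prop) (by fun_prop)]
  have : ((fun x : ℝ => ENNReal.ofReal (Real.exp (-x))) * fun x => ENNReal.ofReal (Real.exp x)) =
      1 := by
    ext x
    simp only [Pi.mul_apply, Pi.one_apply]
    rw [← ENNReal.ofReal_mul (Real.exp_pos _).le, ← Real.exp_add]
    simp
  rw [this, withDensity_one]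

lemma lintegral_expPi_prod (g : ι → ℝ → ℝ≥0∞) (hg : ∀ i, Measurable (g i)) :
    ∫⁻ x, ∏ i, g i (x i) ∂(expPi ι) = ∏ i, ∫⁻ x, g i x ∂(expMeasure 1) := by
  have hind : iIndepFun (fun i (x : ι → ℝ) => g i (x i)) (expPi ι) :=
    iIndepFun_pi (fun i => (hg i).aemeasurable)
  have := lintegral_prod_eq_prod_lintegral_of_indepFun Finset.univ _ hind
    (fun i => (hg i).comp (measurable_pi_apply i))
  rw [this]
  refine Finset.prod_congr rfl fun i _ => ?_
  exact (measurePreserving_eval (fun _ : ι => expMeasure 1) i).lintegral_comp (hg i)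

lemma orthantMeasure_eq_withDensity :
    orthantMeasure ι = (expPi ι).withDensity fun x => ∏ i, ENNReal.ofReal (Real.exp (x i)) := by
  refine Measure.pi_eq fun s hs => ?_
  have hbox : MeasurableSet (Set.univ.pi s) := MeasurableSet.univ_pi hs
  rw [withDensity_apply _ hbox, ← lintegral_indicator hbox]
  have : (Set.univ.pi s).indicator (fun x : ι → ℝ => ∏ i, ENNReal.ofReal (Real.exp (x i))) =
      fun x => ∏ i, (s i).indicator (fun y => ENNReal.ofReal (Real.exp y)) (x i) := by
    ext x
    by_cases h : x ∈ Set.univ.pi s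
    · rw [Set.indicator_of_mem h]
      exact Finset.prod_congr rfl fun i _ => (Set.indicator_of_mem (h i trivial) (fun y => ENNReal.ofReal (Real.exp y))).symm
    · rw [Set.indicator_of_notMem h]
      simp only [Set.mem_pi, Set.mem_univ, true_implies, not_forall] at h
      obtain ⟨i, hi⟩ := h
      exact (Finset.prod_eq_zero (Finset.mem_univ i) (Set.indicator_of_notMem hi _)).symm
  rw [this, lintegral_expPi_prod _ fun i => Measurable.indicator (by fun_prop) (hs i)]
  refine Finset.prod_congr rfl fun i _ => ?_
  rw [lintegral_indicator (hs i), restrict_Ioi_eq_withDensity, withDensity_apply _ (hs i)]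

lemma ofReal_exp_sum (c : ι → ℝ) :
    ENNReal.ofReal (Real.exp (∑ i, c i)) = ∏ i, ENNReal.ofReal (Real.exp (c i)) := by
  rw [Real.exp_sum, ENNReal.ofReal_prod_of_nonneg fun i _ => (Real.exp_pos _).le]

lemma expPi_eq_withDensity :
    expPi ι = (orthantMeasure ι).withDensity
      fun x => ENNReal.ofReal (Real.exp (-∑ i, x i)) := by
  rw [orthantMeasure_eq_withDensity, ← withDensity_mul _ (by fun_prop) (by fun_prop)]
  have : ((fun x : ι → ℝ => ∏ i, ENNReal.ofReal (Real.exp (x i))) *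
      fun x => ENNReal.ofReal (Real.exp (-∑ i, x i))) = 1 := by
    ext x
    simp only [Pi.mul_apply, Pi.one_apply]
    rw [← ofReal_exp_sum, ← ENNReal.ofReal_mul (Real.exp_pos _).le, ← Real.exp_add]
    simp
  rw [this, withDensity_one]

lemma lintegral_orthantMeasure_prod (g : ι → ℝ → ℝ≥0∞) (hg : ∀ i, Measurable (g i)) :
    ∫⁻ x, ∏ i, g i (x i) ∂(orthantMeasure ι) = ∏ i, ∫⁻ x in Set.Ioi 0, g i x := by
  have hm : Measurable fun x : ι → ℝ => ∏ i, g i (x i) :=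
    Finset.measurable_prod _ fun i _ => (hg i).comp (measurable_pi_apply i)
  rw [orthantMeasure_eq_withDensity, lintegral_withDensity_eq_lintegral_mul _ (by fun_prop) hm]
  simp only [Pi.mul_apply, ← Finset.prod_mul_distrib]
  rw [lintegral_expPi_prod (fun i x => ENNReal.ofReal (Real.exp x) * g i x)
    fun i => Measurable.mul (by fun_prop) (hg i)]
  refine Finset.prod_congr rfl fun i _ => ?_
  rw [restrict_Ioi_eq_withDensity, lintegral_withDensity_eq_lintegral_mul _ (by fun_prop) (hg i)]
  rfl

lemma ae_expPi_pos : ∀ᵐ x ∂(expPi ι), ∀ i, 0 < x i := by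
  rw [expPi_eq_withDensity]
  exact (withDensity_absolutelyContinuous _ _).ae_le ae_orthantMeasure_pos

/-- A family of different coordinates is again a family of independent exponential variables. -/
lemma measurePreserving_expPi_comp {κ : Type*} [Fintype κ] (σ : κ → ι)
    (hσ : Function.Injective σ) :
    MeasurePreserving (fun x : ι → ℝ => x ∘ σ) (expPi ι) (expPi κ) := by
  refine ⟨by unfold Function.comp; fun_prop, ?_⟩
  have hind : iIndepFun (fun i (x : ι → ℝ) => x i) (expPi ι) :=
    iIndepFun_pi (X := fun _ x => x) fun i => aemeasurable_id
  have h := (iIndepFun_iff_map_fun_eq_pi_map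
    (fun i => (measurable_pi_apply (σ i)).aemeasurable)).1 (hind.precomp hσ)
  have h2 : ∀ i : κ, (expPi ι).map (fun x => x (σ i)) = expMeasure 1 := fun i =>
    (measurePreserving_eval (fun _ : ι => expMeasure 1) (σ i)).map_eq
  simp only [h2] at h
  exact h

end Exponential

lemma lintegral_Ioi_exp {a : ℝ} (ha : a < 0) :
    ∫⁻ x in Set.Ioi (0 : ℝ), ENNReal.ofReal (Real.exp (a * x)) = ENNReal.ofReal (1 / -a) := by
  rw [← ofReal_integral_eq_lintegral_ofReal (integrableOn_exp_mul_Ioi ha 0)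
    (Filter.Eventually.of_forall fun x => (Real.exp_pos _).le), integral_exp_mul_Ioi ha 0]
  simp [neg_div, div_neg]

lemma lintegral_expMeasure_exp {a : ℝ} (ha : a < 1) :
    ∫⁻ x, ENNReal.ofReal (Real.exp (a * x)) ∂(expMeasure 1) = ENNReal.ofReal (1 / (1 - a)) := by
  rw [expMeasure_eq_withDensity, lintegral_withDensity_eq_lintegral_mul _ (by fun_prop)
    (by fun_prop)]
  have : ((fun x : ℝ => ENNReal.ofReal (Real.exp (-x))) *
      fun x => ENNReal.ofReal (Real.exp (a * x))) =
      fun x => ENNReal.ofReal (Real.exp ((a - 1) * x)) := by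
    ext x
    rw [Pi.mul_apply, ← ENNReal.ofReal_mul (Real.exp_pos _).le, ← Real.exp_add]
    ring_nf
  rw [this, lintegral_Ioi_exp (by linarith)]
  ring_nf

lemma integral_expMeasure_cexp {z : ℂ} (hz : z.re < 1) :
    ∫ x : ℝ, Complex.exp (z * x) ∂(expMeasure 1) = 1 / (1 - z) := by
  rw [expMeasure_eq_withDensity, integral_withDensity_eq_integral_toReal_smul (by fun_prop)
    (by simp)]
  have : ∀ x : ℝ, (ENNReal.ofReal (Real.exp (-x))).toReal • Complex.exp (z * x) =
      Complex.exp ((z - 1) * x) := by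
    intro x
    rw [ENNReal.toReal_ofReal (Real.exp_pos _).le, Complex.real_smul, Complex.ofReal_exp,
      ← Complex.exp_add]
    push_cast
    ring_nf
  simp_rw [this]
  rw [integral_exp_mul_complex_Ioi (by simpa using hz)]
  have h0 : z - 1 ≠ 0 := by
    intro h
    have := congrArg Complex.re h
    simp at this
    linarith
  have h1 : 1 - z ≠ 0 := by
    intro h
    exact h0 (by linear_combination -h)
  simp only [Complex.ofReal_zero, mul_zero, Complex.exp_zero]
  field_simp
  ring

section

variable {ι : Type*} [Fintype ι] [DecidableEq ι]

lemma indepFun_update (e : ι) :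
    IndepFun (fun x : ι → ℝ => x e) (fun x : ι → ℝ => Function.update x e 0) (expPi ι) := by
  have hind : iIndepFun (fun i (x : ι → ℝ) => x i) (expPi ι) :=
    iIndepFun_pi (X := fun _ x => x) fun i => aemeasurable_id
  have h := hind.indepFun_finset {e} (Finset.univ.erase e) (by simp) fun i => measurable_pi_apply i
  have hφ : Measurable fun y : (({e} : Finset ι) → ℝ) => y ⟨e, by simp⟩ := measurable_pi_apply _
  have hψ : Measurable fun (y : ↥(Finset.univ.erase e) → ℝ) (i : ι) =>
      if hi : i ∈ Finset.univ.erase e then y ⟨i, hi⟩ else 0 := by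
    refine measurable_pi_lambda _ fun i => ?_
    by_cases hi : i ∈ Finset.univ.erase e
    · simp only [hi, dif_pos]; exact measurable_pi_apply _
    · simp only [hi, dif_neg, not_false_eq_true]; exact measurable_const
  have h2 := h.comp hφ hψ
  have h3 : (fun x : ι → ℝ => Function.update x e 0) = fun x i =>
      if i ∈ Finset.univ.erase e then x i else 0 := by
    funext x i
    by_cases hi : i = e
    · subst hi; simp
    · simp [hi]
  rw [h3]
  exact h2

/-- The unit vectors of `A` times `x e` are split off from the coordinates in `A`. -/
lemma shear_one_eq {ι : Type*} [DecidableEq ι] (A : Finset ι) (e : ι) (he : e ∈ A) (x : ι → ℝ) :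
    shear A (fun _ => 1) e x =
      fun f => Function.update x e 0 f + x e * (if f ∈ A then 1 else 0) := by
  ext f
  by_cases hf : f = e
  · subst hf; simp [shear, he]
  · simp [shear, hf]

lemma sum_shear_one (A : Finset ι) (e : ι) (he : e ∈ A) (x : ι → ℝ) :
    ∑ f, shear A (fun _ => 1) e x f = ∑ f, x f + (A.card - 1) * x e := by
  unfold shear
  rw [Finset.sum_add_distrib, ← Finset.mul_sum]
  have : ∑ f, (if f ∈ A ∧ f ≠ e then (1 : ℝ) / 1 else 0) = A.card - 1 := by
    have h1 : (A.card : ℝ) - 1 = (A.erase e).card := by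
      rw [Finset.card_erase_of_mem he, Nat.cast_sub (Finset.card_pos.2 ⟨e, he⟩)]; simp
    rw [h1, Finset.sum_ite]
    simp only [div_one, Finset.sum_const, nsmul_eq_mul, mul_one, mul_zero, add_zero]
    congr 2
    ext f
    simp [and_comm]
  rw [this, mul_comm]

/-- The shear with weights 1 increases the coordinate sum by `(A.card - 1) * x e`; the density `exp
(-∑ x)` turns this into the stated weight. -/
lemma expPi_eq_sum_shear (A : Finset ι) (hA : A.Nonempty) :
    expPi ι = ∑ e ∈ A, ((expPi ι).withDensity fun x =>
      ENNReal.ofReal (Real.exp (-((A.card - 1) * x e)))).map (shear A (fun _ => 1) e) := by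
  conv_lhs => rw [expPi_eq_withDensity, orthantMeasure_eq_sum_shear A hA (fun _ => 1) (by simp)]
  ext s hs
  rw [withDensity_apply _ hs, ← lintegral_indicator hs, lintegral_finsetSum_measure,
    Measure.finsetSum_apply]
  refine Finset.sum_congr rfl fun e he => ?_
  have hm := measurable_shear A (fun _ => 1) e
  rw [lintegral_map (Measurable.indicator (by fun_prop) hs) hm, Measure.map_apply hm hs,
    expPi_eq_withDensity, ← withDensity_mul _ (by fun_prop) (by fun_prop),
    withDensity_apply _ (hm hs), ← lintegral_indicator (hm hs)]
  refine lintegral_congr fun x => ?_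
  by_cases hx : shear A (fun _ => 1) e x ∈ s
  · rw [Set.indicator_of_mem hx, Set.indicator_of_mem (show x ∈ _ ⁻¹' s from hx), Pi.mul_apply,
      ← ENNReal.ofReal_mul (Real.exp_pos _).le, ← Real.exp_add, sum_shear_one A e he]
    ring_nf
  · rw [Set.indicator_of_notMem hx, Set.indicator_of_notMem (show x ∉ _ ⁻¹' s from hx)]

/-- The minimum over `A` is subtracted from the coordinates in `A`: expectations of functions that
are multiplied by `exp (z * r)` when these coordinates are increased by `r`. -/
theorem lintegral_expPi_extract (A : Finset ι) (hA : A.Nonempty) {z : ℝ} (hz : z < A.card)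
    (g : (ι → ℝ) → ℝ≥0∞) (hg : Measurable g)
    (hgA : ∀ x r, g (fun f => x f + r * (if f ∈ A then 1 else 0)) =
      ENNReal.ofReal (Real.exp (z * r)) * g x) :
    ∫⁻ x, g x ∂(expPi ι) = ENNReal.ofReal (1 / (A.card - z)) *
      ∑ e ∈ A, ∫⁻ x, g (Function.update x e 0) ∂(expPi ι) := by
  conv_lhs => rw [expPi_eq_sum_shear A hA]
  rw [lintegral_finsetSum_measure, Finset.mul_sum]
  refine Finset.sum_congr rfl fun e he => ?_
  have hm := measurable_shear A (fun _ => 1) e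
  have hu : Measurable fun x : ι → ℝ => Function.update x e 0 := by
    fun_prop
  rw [lintegral_map hg hm, lintegral_withDensity_eq_lintegral_mul _ (by fun_prop)
    (show Measurable fun x => g (shear A (fun _ => 1) e x) from hg.comp hm)]
  -- The sheared point is the point with `e` zeroed, raised by `x e` on all of `A`. By `hgA` the
  -- integrand splits into a function of `x e` and a function of the other coordinates, which are
  -- independent.
  have h1 : ∀ x : ι → ℝ, ((fun x : ι → ℝ => ENNReal.ofReal (Real.exp (-((A.card - 1) * x e)))) *
      (fun x => g (shear A (fun _ => 1) e x))) x =
      ((fun x : ι → ℝ => ENNReal.ofReal (Real.exp ((z - (A.card - 1)) * x e))) *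
        fun x => g (Function.update x e 0)) x := by
    intro x
    simp only [Pi.mul_apply]
    rw [shear_one_eq A e he, hgA, ← mul_assoc, ← ENNReal.ofReal_mul (Real.exp_pos _).le,
      ← Real.exp_add]
    ring_nf
  have h3 := lintegral_mul_eq_lintegral_mul_lintegral_of_indepFun (by fun_prop)
    (hg.comp hu) ((indepFun_update e).comp
      (φ := fun y => ENNReal.ofReal (Real.exp ((z - (A.card - 1)) * y))) (by fun_prop) hg)
  rw [lintegral_congr h1]
  refine h3.trans ?_
  congr 1
  have h2 := (measurePreserving_eval (fun _ : ι => expMeasure 1) e).lintegral_comp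
    (f := fun y => ENNReal.ofReal (Real.exp ((z - (A.card - 1)) * y))) (by fun_prop)
  refine h2.trans ?_
  rw [lintegral_expMeasure_exp (by linarith)]
  ring_nf

/-- The minimum over `A` is subtracted from the coordinates in `A`: expectations of functions that
are multiplied by `exp (z * r)` when these coordinates are increased by `r`. -/
theorem integral_expPi_extract (A : Finset ι) (hA : A.Nonempty) {z : ℂ} (hz : z.re < A.card)
    (g : (ι → ℝ) → ℂ) (hg : Measurable g) (hint : Integrable g (expPi ι))
    (hgA : ∀ x (r : ℝ), g (fun f => x f + r * (if f ∈ A then 1 else 0)) =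
      Complex.exp (z * r) * g x) :
    ∫ x, g x ∂(expPi ι) = 1 / (A.card - z) *
      ∑ e ∈ A, ∫ x, g (Function.update x e 0) ∂(expPi ι) := by
  rw [expPi_eq_sum_shear A hA, integrable_finsetSum_measure] at hint
  conv_lhs => rw [expPi_eq_sum_shear A hA]
  rw [integral_finsetSum_measure hint, Finset.mul_sum]
  refine Finset.sum_congr rfl fun e he => ?_
  have hm := measurable_shear A (fun _ => 1) e
  have hu : Measurable fun x : ι → ℝ => Function.update x e 0 := by
    fun_prop
  rw [integral_map hm.aemeasurable hg.aestronglyMeasurable,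
    integral_withDensity_eq_integral_toReal_smul (by fun_prop) (by simp)]
  have h1 : ∀ x : ι → ℝ, (ENNReal.ofReal (Real.exp (-((A.card - 1) * x e)))).toReal •
      g (shear A (fun _ => 1) e x) =
      Complex.exp ((z - (A.card - 1)) * x e) * g (Function.update x e 0) := by
    intro x
    rw [shear_one_eq A e he, hgA, ENNReal.toReal_ofReal (Real.exp_pos _).le, Complex.real_smul,
      Complex.ofReal_exp, ← mul_assoc, ← Complex.exp_add]
    push_cast
    ring_nf
  have hφ : Measurable fun y : ℝ => Complex.exp ((z - (A.card - 1)) * y) := by fun_prop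
  simp_rw [h1]
  have h3 := ((indepFun_update e).comp hφ hg).integral_fun_mul_eq_mul_integral
    (hφ.comp (measurable_pi_apply e)).aestronglyMeasurable (hg.comp hu).aestronglyMeasurable
  simp only [Function.comp_apply] at h3
  rw [h3]
  congr 1
  have h2 := (integral_map (measurable_pi_apply e).aemeasurable
    hφ.aestronglyMeasurable (μ := expPi ι))
  rw [show (expPi ι).map (fun x => x e) = expMeasure 1 from
    (measurePreserving_eval (fun _ : ι => expMeasure 1) e).map_eq] at h2
  refine h2.symm.trans ?_
  rw [integral_expMeasure_cexp (by simp; linarith)]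
  ring_nf

end

/-! ### Rationality of integrals over the orthant -/

/-- The rational function `F` has no pole at `t` and takes the value `v` there. -/
def HasValueAt (F : RatFunc ℂ) (t v : ℂ) : Prop :=
  F.denom.eval t ≠ 0 ∧ F.eval (RingHom.id ℂ) t = v

lemma HasValueAt.add {F G : RatFunc ℂ} {t v w : ℂ} (hF : HasValueAt F t v)
    (hG : HasValueAt G t w) : HasValueAt (F + G) t (v + w) := by
  refine ⟨fun h => ?_, ?_⟩
  · have := Polynomial.eval_dvd (x := t) (RatFunc.denom_add_dvd F G)
    rw [h, zero_dvd_iff, Polynomial.eval_mul] at this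
    exact (mul_ne_zero hF.1 hG.1) this
  · rw [RatFunc.eval_add _ _ hF.1 hG.1, hF.2, hG.2]

lemma HasValueAt.mul {F G : RatFunc ℂ} {t v w : ℂ} (hF : HasValueAt F t v)
    (hG : HasValueAt G t w) : HasValueAt (F * G) t (v * w) := by
  refine ⟨fun h => ?_, ?_⟩
  · have := Polynomial.eval_dvd (x := t) (RatFunc.denom_mul_dvd F G)
    rw [h, zero_dvd_iff, Polynomial.eval_mul] at this
    exact (mul_ne_zero hF.1 hG.1) this
  · rw [RatFunc.eval_mul _ _ hF.1 hG.1, hF.2, hG.2]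

lemma hasValueAt_one (t : ℂ) : HasValueAt 1 t 1 := by simp [HasValueAt]

lemma HasValueAt.prod {κ : Type*} (s : Finset κ) {F : κ → RatFunc ℂ} {t : ℂ} {v : κ → ℂ}
    (h : ∀ i ∈ s, HasValueAt (F i) t (v i)) : HasValueAt (∏ i ∈ s, F i) t (∏ i ∈ s, v i) := by
  classical
  induction s using Finset.induction_on with
  | empty => simpa using hasValueAt_one t
  | insert i s hi ih =>
    rw [Finset.prod_insert hi, Finset.prod_insert hi]
    exact (h i (Finset.mem_insert_self i s)).mul
      (ih fun j hj => h j (Finset.mem_insert_of_mem hj))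

lemma hasValueAt_inv (p : Polynomial ℂ) {t : ℂ} (h : p.eval t ≠ 0) :
    HasValueAt (algebraMap _ (RatFunc ℂ) p)⁻¹ t (p.eval t)⁻¹ := by
  have hp : p ≠ 0 := by rintro rfl; simp at h
  have hx : algebraMap _ (RatFunc ℂ) p ≠ 0 := RatFunc.algebraMap_ne_zero hp
  have hd : ((algebraMap _ (RatFunc ℂ) p)⁻¹).denom.eval t ≠ 0 := by
    intro h0
    have := Polynomial.eval_dvd (x := t) (RatFunc.denom_inv_dvd hx)
    rw [h0, zero_dvd_iff, RatFunc.num_algebraMap] at this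
    exact h this
  refine ⟨hd, ?_⟩
  have h1 := RatFunc.eval_mul (RingHom.id ℂ) t (x := (algebraMap _ (RatFunc ℂ) p)⁻¹)
    (y := algebraMap _ (RatFunc ℂ) p) hd (by simp)
  rw [inv_mul_cancel₀ hx, RatFunc.eval_one, RatFunc.eval_algebraMap] at h1
  simp only [Algebra.algebraMap_self, RingHom.id_apply] at h1
  rw [Polynomial.eval₂_id] at h1
  exact eq_inv_of_mul_eq_one_left h1.symm

section

variable {ι κ : Type*} [Fintype ι]

/-- `exp (-w x + t * min_k (l k x))` for linear forms `w` and `l k`, `k ∈ s`. -/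
noncomputable def expMinForm (w : ι → ℝ) (l : κ → ι → ℝ) (s : Finset κ) (hs : s.Nonempty)
    (t : ℂ) (x : ι → ℝ) : ℂ :=
  Complex.exp (-((∑ i, w i * x i : ℝ) : ℂ) + t * ((s.inf' hs fun k => ∑ i, l k i * x i : ℝ) : ℂ))

lemma measurable_expMinForm (w : ι → ℝ) (l : κ → ι → ℝ) (s : Finset κ) (hs : s.Nonempty)
    (t : ℂ) : Measurable (expMinForm w l s hs t) := by
  have : Continuous fun x : ι → ℝ => s.inf' hs fun k => ∑ i, l k i * x i :=
    Continuous.finset_inf'_apply hs fun k _ => by fun_prop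
  unfold expMinForm
  have h := this.measurable
  fun_prop

/-- The coefficients of the linear form `v` after `shear A a e`. -/
noncomputable def shearForm [DecidableEq ι] (A : Finset ι) (a : ι → ℝ) (e : ι) (v : ι → ℝ) :
    ι → ℝ :=
  fun f => v f + if f = e then ∑ g, v g * (if g ∈ A ∧ g ≠ e then a g / a e else 0) else 0

lemma sum_mul_shear [DecidableEq ι] (A : Finset ι) (a : ι → ℝ) (e : ι) (v x : ι → ℝ) :
    ∑ i, v i * shear A a e x i = ∑ i, shearForm A a e v i * x i := by
  simp only [shear, shearForm, mul_add, add_mul, Finset.sum_add_distrib, ite_mul, zero_mul,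
    Finset.sum_ite_eq', Finset.mem_univ, if_true, Finset.sum_mul]
  congr 1
  exact Finset.sum_congr rfl fun i _ => by ring

lemma expMinForm_shear [DecidableEq ι] (A : Finset ι) (a : ι → ℝ) (e : ι) (w : ι → ℝ)
    (l : κ → ι → ℝ) (s : Finset κ) (hs : s.Nonempty) (t : ℂ) (x : ι → ℝ) :
    expMinForm w l s hs t (shear A a e x) =
      expMinForm (shearForm A a e w) (fun k => shearForm A a e (l k)) s hs t x := by
  simp only [expMinForm, sum_mul_shear]

/-- `t ↦ ∫ expMinForm w l s hs t` is a rational function, without poles where this converges. -/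
def RationalIntegral (w : ι → ℝ) (l : κ → ι → ℝ) (s : Finset κ) (hs : s.Nonempty) : Prop :=
  ∃ F : RatFunc ℂ, ∀ t : ℂ, Integrable (expMinForm w l s hs t) (orthantMeasure ι) →
    HasValueAt F t (∫ x, expMinForm w l s hs t x ∂(orthantMeasure ι))

/-- Convergence on the orthant forces convergence on both pieces, so the two rational functions are
pole-free at `t` and can be added. -/
lemma rationalIntegral_of_shear [DecidableEq ι] {w : ι → ℝ} {l : κ → ι → ℝ} {s : Finset κ}
    {hs : s.Nonempty} (a : ι → ℝ) (ha : ∀ i, 0 < a i) {i j : ι} (hij : i ≠ j)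
    (hi : RationalIntegral (shearForm {i, j} a i w) (fun k => shearForm {i, j} a i (l k)) s hs)
    (hj : RationalIntegral (shearForm {i, j} a j w) (fun k => shearForm {i, j} a j (l k)) s hs) :
    RationalIntegral w l s hs := by
  obtain ⟨F, hF⟩ := hi
  obtain ⟨G, hG⟩ := hj
  refine ⟨F + G, fun t ht => ?_⟩
  have hm := measurable_expMinForm w l s hs t
  have hν := orthantMeasure_eq_sum_shear (ι := ι) {i, j} (by simp) a ha
  rw [hν] at ht ⊢
  have ht' := ht
  rw [integrable_finsetSum_measure] at ht'
  rw [integral_finsetSum_measure ht', Finset.sum_pair hij]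
  have key : ∀ e ∈ ({i, j} : Finset ι),
      Integrable (expMinForm (shearForm {i, j} a e w) (fun k => shearForm {i, j} a e (l k)) s hs t)
        (orthantMeasure ι) := by
    intro e he
    have h1 := ht' e he
    rw [integrable_map_measure hm.aestronglyMeasurable (measurable_shear _ _ _).aemeasurable] at h1
    refine h1.congr (Filter.Eventually.of_forall fun x => ?_)
    exact expMinForm_shear _ _ _ _ _ _ _ _ _
  have val : ∀ e : ι, ∫ x, expMinForm w l s hs t x ∂((orthantMeasure ι).map (shear {i, j} a e)) =
      ∫ x, expMinForm (shearForm {i, j} a e w) (fun k => shearForm {i, j} a e (l k)) s hs t x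
        ∂(orthantMeasure ι) := by
    intro e
    rw [integral_map (measurable_shear _ _ _).aemeasurable hm.aestronglyMeasurable]
    simp only [expMinForm_shear]
  rw [val, val]
  exact (hF t (key i (by simp))).add (hG t (key j (by simp)))

/-- On the positive orthant a form with larger coefficients never lowers the minimum. -/
lemma rationalIntegral_of_erase [DecidableEq κ] {w : ι → ℝ} {l : κ → ι → ℝ} {s : Finset κ}
    {hs : s.Nonempty} {k₀ k₁ : κ} (h₀ : k₀ ∈ s) (hne : k₀ ≠ k₁)
    (hle : ∀ i, l k₀ i ≤ l k₁ i)
    (h : RationalIntegral w l (s.erase k₁) ⟨k₀, Finset.mem_erase.2 ⟨hne, h₀⟩⟩) :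
    RationalIntegral w l s hs := by
  obtain ⟨F, hF⟩ := h
  refine ⟨F, fun t ht => ?_⟩
  have hae : expMinForm w l s hs t =ᵐ[orthantMeasure ι]
      expMinForm w l (s.erase k₁) ⟨k₀, Finset.mem_erase.2 ⟨hne, h₀⟩⟩ t := by
    filter_upwards [ae_orthantMeasure_pos] with x hx
    have : (s.inf' hs fun k => ∑ i, l k i * x i) =
        (s.erase k₁).inf' ⟨k₀, Finset.mem_erase.2 ⟨hne, h₀⟩⟩ fun k => ∑ i, l k i * x i := by
      refine le_antisymm (Finset.inf'_mono _ (Finset.erase_subset _ _) _) ?_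
      refine Finset.le_inf' _ _ fun k hk => ?_
      by_cases hk1 : k = k₁
      · subst hk1
        refine (Finset.inf'_le _ (Finset.mem_erase.2 ⟨hne, h₀⟩)).trans ?_
        exact Finset.sum_le_sum fun i _ => mul_le_mul_of_nonneg_right (hle i) (hx i).le
      · exact Finset.inf'_le _ (Finset.mem_erase.2 ⟨hk1, hk⟩)
    simp only [expMinForm, this]
  rw [integral_congr_ae hae]
  exact hF t (ht.congr hae)

lemma lintegral_Ioi_exp_eq_top {a : ℝ} (ha : 0 ≤ a) :
    ∫⁻ x in Set.Ioi (0 : ℝ), ENNReal.ofReal (Real.exp (a * x)) = ∞ := by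
  refine eq_top_iff.2 ?_
  calc ∞ = ∫⁻ _ in Set.Ioi (0 : ℝ), 1 := by simp
    _ ≤ _ := by
      refine setLIntegral_mono (by fun_prop) fun x hx => ?_
      rw [← ENNReal.ofReal_one]
      exact ENNReal.ofReal_le_ofReal (Real.one_le_exp (mul_nonneg ha (le_of_lt hx)))

lemma rationalIntegral_singleton (w : ι → ℝ) (l : κ → ι → ℝ) (k : κ) :
    RationalIntegral w l {k} (Finset.singleton_nonempty k) := by
  refine ⟨∏ i, (algebraMap _ (RatFunc ℂ)
    (Polynomial.C (w i : ℂ) - Polynomial.C (l k i : ℂ) * Polynomial.X))⁻¹, fun t ht => ?_⟩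
  have hform : ∀ x, expMinForm w l {k} (Finset.singleton_nonempty k) t x =
      ∏ i, Complex.exp ((-w i + t * l k i) * x i) := by
    intro x
    rw [expMinForm, Finset.inf'_singleton, ← Complex.exp_sum]
    congr 1
    push_cast
    rw [Finset.mul_sum, ← Finset.sum_neg_distrib, ← Finset.sum_add_distrib]
    exact Finset.sum_congr rfl fun i _ => by ring
  -- A coordinate with nonnegative exponent contributes an infinite factor to the integral of the
  -- norm, and no other factor is zero, so convergence would fail.
  have hneg : ∀ i, (-w i + t * l k i : ℂ).re < 0 := by
    by_contra! hcon
    obtain ⟨i, hi⟩ := hcon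
    have h1 := ht.hasFiniteIntegral
    rw [hasFiniteIntegral_iff_norm] at h1
    have h2 : ∀ x, ENNReal.ofReal ‖expMinForm w l {k} (Finset.singleton_nonempty k) t x‖ =
        ∏ i, ENNReal.ofReal (Real.exp ((-w i + t * l k i : ℂ).re * x i)) := by
      intro x
      rw [hform, norm_prod, ENNReal.ofReal_prod_of_nonneg fun _ _ => norm_nonneg _]
      refine Finset.prod_congr rfl fun i _ => ?_
      rw [Complex.norm_exp, Complex.re_mul_ofReal]
    classical
    rw [lintegral_congr h2, lintegral_orthantMeasure_prod
      (fun i y => ENNReal.ofReal (Real.exp ((-w i + t * l k i : ℂ).re * y))) (by fun_prop),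
      ← Finset.mul_prod_erase _ _ (Finset.mem_univ i), lintegral_Ioi_exp_eq_top hi,
      ENNReal.top_mul] at h1
    · exact lt_irrefl _ h1
    · refine Finset.prod_ne_zero_iff.2 fun j _ => ?_
      rcases lt_or_ge (-w j + t * l k j : ℂ).re 0 with h | h
      · rw [lintegral_Ioi_exp h]
        exact (ENNReal.ofReal_pos.2 (by simpa using h)).ne'
      · rw [lintegral_Ioi_exp_eq_top h]; simp
  have hint : ∫ x, expMinForm w l {k} (Finset.singleton_nonempty k) t x ∂(orthantMeasure ι) =
      ∏ i, (Polynomial.eval t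
        (Polynomial.C (w i : ℂ) - Polynomial.C (l k i : ℂ) * Polynomial.X))⁻¹ := by
    simp_rw [hform]
    have := integral_fintype_prod_eq_prod (𝕜 := ℂ)
      (μ := fun _ : ι => volume.restrict (Set.Ioi (0 : ℝ)))
      (fun i (y : ℝ) => Complex.exp ((-w i + t * l k i) * y))
    refine this.trans (Finset.prod_congr rfl fun i _ => ?_)
    rw [integral_exp_mul_complex_Ioi (hneg i)]
    simp only [Complex.ofReal_zero, mul_zero, Complex.exp_zero, Polynomial.eval_sub,
      Polynomial.eval_C, Polynomial.eval_mul, Polynomial.eval_X]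
    rw [neg_div, one_div, ← neg_inv.symm]
    congr 1
    ring
  rw [hint]
  refine HasValueAt.prod _ fun i _ => hasValueAt_inv _ fun h => ?_
  have h1 : (-w i + t * l k i : ℂ) = 0 := by
    simp only [Polynomial.eval_sub, Polynomial.eval_C, Polynomial.eval_mul,
      Polynomial.eval_X] at h
    linear_combination -h
  have := hneg i
  rw [h1] at this
  simp at this

lemma shearForm_sub [DecidableEq ι] (A : Finset ι) (a : ι → ℝ) (e : ι) (v v' : ι → ℝ) (f : ι) :
    shearForm A a e v f - shearForm A a e v' f = shearForm A a e (fun i => v i - v' i) f := by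
  unfold shearForm
  split_ifs
  · simp only [sub_mul, Finset.sum_sub_distrib]; ring
  · ring

/-- Weights for which both shears along two coordinates where `h` has opposite signs make one of
the coefficients of `h` vanish. -/
lemma shearForm_card_lt [DecidableEq ι] (h a : ι → ℝ) {i j : ι} (hij : i ≠ j)
    (hi : h i ≠ 0) (hcancel : h i * a i + h j * a j = 0) (hai : a i ≠ 0) (A : Finset ι)
    (hA : A = {i, j}) :
    (Finset.univ.filter fun f => shearForm A a i h f ≠ 0).card <
      (Finset.univ.filter fun f => h f ≠ 0).card := by
  subst hA
  -- The shear changes only the coefficient at `i`, which becomes `h i + h j * a j / a i = 0`.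
  have hzero : shearForm {i, j} a i h i = 0 := by
    have : ∀ g, h g * (if g ∈ ({i, j} : Finset ι) ∧ g ≠ i then a g / a i else 0) =
        if g = j then h j * (a j / a i) else 0 := by
      intro g
      by_cases hg : g = j
      · subst hg; simp [hij.symm]
      · by_cases hgi : g = i <;> simp [hg, hgi, hij]
    simp only [shearForm, if_true, this, Finset.sum_ite_eq', Finset.mem_univ]
    field_simp
    linarith
  refine Finset.card_lt_card ?_
  rw [Finset.ssubset_iff_of_subset]
  · exact ⟨i, by simpa using hi, by simpa using hzero⟩
  · intro f hf
    simp only [Finset.mem_filter, Finset.mem_univ, true_and] at hf ⊢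
    by_cases hfi : f = i
    · subst hfi; exact absurd hzero hf
    · simpa [shearForm, hfi] using hf

/-- Integrals of the exponential of a minimum of linear forms over the orthant are rational. -/
theorem rationalIntegral (w : ι → ℝ) (l : κ → ι → ℝ) (s : Finset κ) (hs : s.Nonempty) :
    RationalIntegral w l s hs := by
  classical
  -- Outer induction on the number of forms; inner induction, for two chosen forms, on the number of
  -- coordinates where their coefficients differ. Comparable forms allow one to be dropped.
  induction hN : s.card using Nat.strong_induction_on generalizing w l s with
  | _ N ihN =>
  by_cases hcard : s.card = 1
  · obtain ⟨k, rfl⟩ := Finset.card_eq_one.1 hcard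
    exact rationalIntegral_singleton w l k
  have h1 : 1 < s.card := lt_of_le_of_ne (Finset.card_pos.2 hs) (Ne.symm hcard)
  obtain ⟨k₀, h₀, k₁, h₁, hne⟩ := Finset.one_lt_card.1 h1
  induction hd : (Finset.univ.filter fun f => l k₀ f - l k₁ f ≠ 0).card
    using Nat.strong_induction_on generalizing w l with
  | _ d ihd =>
  by_cases hle : ∀ i, l k₀ i ≤ l k₁ i
  · exact rationalIntegral_of_erase h₀ hne hle
      (ihN _ (hN ▸ Finset.card_erase_lt_of_mem h₁) _ _ _ _ rfl)
  by_cases hge : ∀ i, l k₁ i ≤ l k₀ i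
  · exact rationalIntegral_of_erase h₁ hne.symm hge
      (ihN _ (hN ▸ Finset.card_erase_lt_of_mem h₀) _ _ _ _ rfl)
  push Not at hle hge
  obtain ⟨i, hi⟩ := hle
  obtain ⟨j, hj⟩ := hge
  set h : ι → ℝ := fun f => l k₀ f - l k₁ f with hh
  have hi' : 0 < h i := sub_pos.2 hi
  have hj' : h j < 0 := sub_neg.2 hj
  have hij : i ≠ j := by rintro rfl; exact lt_asymm hi hj
  -- Reciprocals of `|h|` give `h i * a i = 1` and `h j * a j = -1`, so the difference of the two
  -- forms loses a coefficient in both pieces.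
  set a : ι → ℝ := fun f => if h f = 0 then 1 else |h f|⁻¹ with haf
  have ha : ∀ f, 0 < a f := by
    intro f
    simp only [haf]
    split_ifs with hf
    · exact one_pos
    · exact inv_pos.2 (abs_pos.2 hf)
  have hai : h i * a i = 1 := by
    simp only [haf, hi'.ne', if_false, abs_of_pos hi']
    exact mul_inv_cancel₀ hi'.ne'
  have haj : h j * a j = -1 := by
    simp only [haf, hj'.ne, if_false, abs_of_neg hj']
    rw [inv_neg, mul_neg, mul_inv_cancel₀ hj'.ne]
  refine rationalIntegral_of_shear a ha hij ?_ ?_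
  · refine ihd _ ?_ _ _ rfl
    rw [← hd]
    simp only [shearForm_sub]
    exact shearForm_card_lt h a hij hi'.ne' (by linarith) (ha i).ne' _ rfl
  · refine ihd _ ?_ _ _ rfl
    rw [← hd]
    simp only [shearForm_sub]
    exact shearForm_card_lt h a hij.symm hj'.ne (by linarith) (ha j).ne' _ (Finset.pair_comm i j)

end

/-! ### Minimum costs, matchings and their relaxations -/

section SetMin

variable {ι : Type*} [Fintype ι]

/-- The minimum total cost of a set with the property `P`. -/
noncomputable def setMin (P : Finset ι → Prop) (c : ι → ℝ) : ℝ :=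
  ⨅ M : {M : Finset ι // P M}, ∑ e ∈ M.1, c e

variable {P : Finset ι → Prop}

lemma setMin_le (c : ι → ℝ) {M : Finset ι} (hM : P M) : setMin P c ≤ ∑ e ∈ M, c e :=
  ciInf_le (Set.finite_range fun M : {M : Finset ι // P M} => ∑ e ∈ M.1, c e).bddBelow ⟨M, hM⟩

lemma exists_setMin (hP : ∃ M, P M) (c : ι → ℝ) : ∃ M, P M ∧ setMin P c = ∑ e ∈ M, c e := by
  obtain ⟨M₀, hM₀⟩ := hP
  have : Nonempty {M : Finset ι // P M} := ⟨⟨M₀, hM₀⟩⟩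
  obtain ⟨M, hM⟩ := exists_eq_ciInf_of_finite (f := fun M : {M : Finset ι // P M} => ∑ e ∈ M.1, c e)
  exact ⟨M.1, M.2, hM.symm⟩

/-- No admissible set is needed: the infimum of an empty family of reals is 0. -/
lemma setMin_nonneg {ι : Type*} {P : Finset ι → Prop} {c : ι → ℝ} (hc : ∀ e, 0 ≤ c e) :
    0 ≤ setMin P c :=
  Real.iInf_nonneg fun _ => Finset.sum_nonneg fun e _ => hc e

lemma setMin_eq_inf' [DecidablePred P] (h : (Finset.univ.filter P).Nonempty) (c : ι → ℝ) :
    setMin P c = (Finset.univ.filter P).inf' h fun M => ∑ e ∈ M, c e := by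
  obtain ⟨M₀, hM₀⟩ := h
  obtain ⟨M, hM, heq⟩ := exists_setMin ⟨M₀, (Finset.mem_filter.1 hM₀).2⟩ c
  refine le_antisymm (Finset.le_inf' _ _ fun M hM => setMin_le c (Finset.mem_filter.1 hM).2) ?_
  rw [heq]
  exact Finset.inf'_le _ (by simpa using hM)

lemma measurable_setMin (hP : ∃ M, P M) : Measurable (setMin P) := by
  classical
  obtain ⟨M₀, hM₀⟩ := hP
  have h : (Finset.univ.filter P).Nonempty := ⟨M₀, by simpa using hM₀⟩
  have : setMin P = fun c => (Finset.univ.filter P).inf' h fun M => ∑ e ∈ M, c e :=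
    funext fun c => setMin_eq_inf' h c
  rw [this]
  exact (Continuous.finset_inf'_apply h fun M _ => by fun_prop).measurable

/-- The minimum is shifted by `q * r` if each admissible set has `q` elements in `A`. -/
lemma setMin_add [DecidableEq ι] (hP : ∃ M, P M) (A : Finset ι) (q : ℕ)
    (hq : ∀ M, P M → (M ∩ A).card = q) (c : ι → ℝ) (r : ℝ) :
    setMin P (fun f => c f + r * (if f ∈ A then 1 else 0)) = setMin P c + q * r := by
  have hsum : ∀ M, P M → ∑ f ∈ M, (c f + r * (if f ∈ A then 1 else 0)) = ∑ f ∈ M, c f + q * r := by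
    intro M hM
    rw [Finset.sum_add_distrib, ← Finset.mul_sum, ← hq M hM]
    simp [mul_comm]
  refine le_antisymm ?_ ?_
  · obtain ⟨M, hM, heq⟩ := exists_setMin hP c
    rw [heq, ← hsum M hM]
    exact setMin_le _ hM
  · obtain ⟨M, hM, heq⟩ := exists_setMin hP fun f => c f + r * (if f ∈ A then 1 else 0)
    rw [heq, hsum M hM]
    have := setMin_le c hM
    linarith

lemma setMin_mono_property {Q : Finset ι → Prop} (hP : ∃ M, P M) (h : ∀ M, P M → Q M)
    (c : ι → ℝ) : setMin Q c ≤ setMin P c := by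
  obtain ⟨M, hM, heq⟩ := exists_setMin hP c
  rw [heq]
  exact setMin_le c (h M hM)

end SetMin

/-- A set of `k` edges in different rows. -/
def IsRowMatching (k m n : ℕ) (M : Finset (Fin m × Fin n)) : Prop :=
  M.card = k ∧ ∀ e ∈ M, ∀ f ∈ M, e ≠ f → e.1 ≠ f.1

lemma minCost_eq_setMin (k m n : ℕ) : minCost k m n = setMin (IsKMatching k m n) := rfl

lemma IsKMatching.isRowMatching {k m n : ℕ} {M : Finset (Fin m × Fin n)}
    (h : IsKMatching k m n M) : IsRowMatching k m n M :=
  ⟨h.1, fun e he f hf hef => (h.2 e he f hf hef).1⟩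

lemma exists_isKMatching {k m n : ℕ} (hm : k ≤ m) (hn : k ≤ n) : ∃ M, IsKMatching k m n M := by
  refine ⟨Finset.univ.image fun i : Fin k => (Fin.castLE hm i, Fin.castLE hn i), ?_, ?_⟩
  · rw [Finset.card_image_of_injective, Finset.card_univ, Fintype.card_fin]
    intro i j hij
    exact Fin.castLE_injective hm (Prod.mk.inj hij).1
  · intro e he f hf hef
    simp only [Finset.mem_image, Finset.mem_univ, true_and] at he hf
    obtain ⟨i, rfl⟩ := he
    obtain ⟨j, rfl⟩ := hf
    have hij : i ≠ j := by rintro rfl; exact hef rfl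
    exact ⟨fun h => hij (Fin.castLE_injective hm h), fun h => hij (Fin.castLE_injective hn h)⟩

lemma exists_isRowMatching {k m n : ℕ} (hm : k ≤ m) (hn : 1 ≤ n) :
    ∃ M, IsRowMatching k m n M := by
  refine ⟨Finset.univ.image fun i : Fin k => (Fin.castLE hm i, (⟨0, hn⟩ : Fin n)), ?_, ?_⟩
  · rw [Finset.card_image_of_injective, Finset.card_univ, Fintype.card_fin]
    intro i j hij
    exact Fin.castLE_injective hm (Prod.mk.inj hij).1
  · intro e he f hf hef
    simp only [Finset.mem_image, Finset.mem_univ, true_and] at he hf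
    obtain ⟨i, rfl⟩ := he
    obtain ⟨j, rfl⟩ := hf
    have hij : i ≠ j := by rintro rfl; exact hef rfl
    exact fun h => hij (Fin.castLE_injective hm h)

lemma IsKMatching.map {k m n m' n' : ℕ} {M : Finset (Fin m' × Fin n')}
    (hM : IsKMatching k m' n' M) (ρ : Fin m' ↪ Fin m) (σ : Fin n' ↪ Fin n) :
    IsKMatching k m n (M.map (ρ.prodMap σ)) := by
  refine ⟨by rw [Finset.card_map, hM.1], ?_⟩
  intro e he f hf hef
  obtain ⟨p, hp, rfl⟩ := Finset.mem_map.1 he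
  obtain ⟨q, hq, rfl⟩ := Finset.mem_map.1 hf
  have hpq : p ≠ q := by rintro rfl; exact hef rfl
  have h := hM.2 p hp q hq hpq
  exact ⟨fun h' => h.1 (ρ.injective h'), fun h' => h.2 (σ.injective h')⟩

lemma IsRowMatching.map {k m n m' n' : ℕ} {M : Finset (Fin m' × Fin n')}
    (hM : IsRowMatching k m' n' M) (ρ : Fin m' ↪ Fin m) (σ : Fin n' ↪ Fin n) :
    IsRowMatching k m n (M.map (ρ.prodMap σ)) := by
  refine ⟨by rw [Finset.card_map, hM.1], ?_⟩
  intro e he f hf hef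
  obtain ⟨p, hp, rfl⟩ := Finset.mem_map.1 he
  obtain ⟨q, hq, rfl⟩ := Finset.mem_map.1 hf
  have hpq : p ≠ q := by rintro rfl; exact hef rfl
  exact fun h' => hM.2 p hp q hq hpq (ρ.injective h')

lemma IsKMatching.insert {k m n : ℕ} {M : Finset (Fin m × Fin n)} (hM : IsKMatching k m n M)
    {e : Fin m × Fin n} (h₁ : ∀ f ∈ M, f.1 ≠ e.1) (h₂ : ∀ f ∈ M, f.2 ≠ e.2) :
    IsKMatching (k + 1) m n (insert e M) := by
  have he : e ∉ M := fun h => h₁ e h rfl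
  refine ⟨by rw [Finset.card_insert_of_notMem he, hM.1], ?_⟩
  intro f hf g hg hfg
  rcases Finset.mem_insert.1 hf with rfl | hf' <;> rcases Finset.mem_insert.1 hg with rfl | hg'
  · exact absurd rfl hfg
  · exact ⟨(h₁ g hg').symm, (h₂ g hg').symm⟩
  · exact ⟨h₁ f hf', h₂ f hf'⟩
  · exact hM.2 f hf' g hg' hfg

lemma IsRowMatching.insert {k m n : ℕ} {M : Finset (Fin m × Fin n)}
    (hM : IsRowMatching k m n M) {e : Fin m × Fin n} (h₁ : ∀ f ∈ M, f.1 ≠ e.1) :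
    IsRowMatching (k + 1) m n (insert e M) := by
  have he : e ∉ M := fun h => h₁ e h rfl
  refine ⟨by rw [Finset.card_insert_of_notMem he, hM.1], ?_⟩
  intro f hf g hg hfg
  rcases Finset.mem_insert.1 hf with rfl | hf' <;> rcases Finset.mem_insert.1 hg with rfl | hg'
  · exact absurd rfl hfg
  · exact (h₁ g hg').symm
  · exact h₁ f hf'
  · exact hM.2 f hf' g hg' hfg

/-- The edges that have no vertex in common with `e`. -/
def avoidEdge {m n : ℕ} (e : Fin (m + 1) × Fin (n + 1)) :
    Fin m × Fin n ↪ Fin (m + 1) × Fin (n + 1) :=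
  e.1.succAboveEmb.prodMap e.2.succAboveEmb

/-- The edges that are not in the row of `e`. -/
def avoidRow {m n : ℕ} (e : Fin (m + 1) × Fin n) : Fin m × Fin n ↪ Fin (m + 1) × Fin n :=
  e.1.succAboveEmb.prodMap (Function.Embedding.refl _)

/-- A matching that avoids both vertices of `e` can be extended by `e` at no cost. -/
lemma minCost_update_le {k m n : ℕ} (hm : k ≤ m) (hn : k ≤ n)
    (e : Fin (m + 1) × Fin (n + 1)) (c : Fin (m + 1) × Fin (n + 1) → ℝ) :
    minCost (k + 1) (m + 1) (n + 1) (Function.update c e 0) ≤ minCost k m n (c ∘ avoidEdge e) := by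
  obtain ⟨M, hM, heq⟩ := exists_setMin (exists_isKMatching hm hn) (c ∘ avoidEdge e)
  rw [minCost_eq_setMin, minCost_eq_setMin, heq]
  have h₁ : ∀ f ∈ M.map (avoidEdge e), f.1 ≠ e.1 := by
    intro f hf
    obtain ⟨p, _, rfl⟩ := Finset.mem_map.1 hf
    exact Fin.succAbove_ne _ _
  have h₂ : ∀ f ∈ M.map (avoidEdge e), f.2 ≠ e.2 := by
    intro f hf
    obtain ⟨p, _, rfl⟩ := Finset.mem_map.1 hf
    exact Fin.succAbove_ne _ _
  have hins : IsKMatching (k + 1) (m + 1) (n + 1) (insert e (M.map (avoidEdge e))) :=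
    (hM.map _ _).insert h₁ h₂
  refine (setMin_le _ hins).trans_eq ?_
  rw [Finset.sum_insert fun h => h₁ e h rfl, Function.update_self, zero_add, Finset.sum_map]
  refine Finset.sum_congr rfl fun p hp => ?_
  rw [Function.update_of_ne fun h => h₁ _ (Finset.mem_map_of_mem _ hp) (congrArg Prod.fst h)]
  rfl

/-- The minimum total cost of `k` edges in different rows. -/
noncomputable def rowMin (k m n : ℕ) : (Fin m × Fin n → ℝ) → ℝ := setMin (IsRowMatching k m n)

lemma rowMin_le_minCost {k m n : ℕ} (hm : k ≤ m) (hn : k ≤ n) (c : Fin m × Fin n → ℝ) :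
    rowMin k m n c ≤ minCost k m n c :=
  setMin_mono_property (exists_isKMatching hm hn) (fun _ h => h.isRowMatching) c

lemma IsRowMatching.of_map {k m n m' n' : ℕ} {M : Finset (Fin m' × Fin n')} {ρ : Fin m' ↪ Fin m}
    {σ : Fin n' ↪ Fin n} (hM : IsRowMatching k m n (M.map (ρ.prodMap σ))) :
    IsRowMatching k m' n' M := by
  refine ⟨by rw [← hM.1, Finset.card_map], fun p hp q hq hpq h => ?_⟩
  exact hM.2 _ (Finset.mem_map_of_mem _ hp) _ (Finset.mem_map_of_mem _ hq)
    (fun h' => hpq ((ρ.prodMap σ).injective h')) (congrArg ρ h)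

/-- Without column conditions the edge `e` conflicts only with its own row, so the inequality for
matchings becomes an equality. This makes the law of `rowMin` explicitly computable. -/
lemma rowMin_update {k m n : ℕ} (hm : k ≤ m) (hn : 1 ≤ n) (e : Fin (m + 1) × Fin n)
    {c : Fin (m + 1) × Fin n → ℝ} (hc : ∀ f, 0 ≤ c f) :
    rowMin (k + 1) (m + 1) n (Function.update c e 0) = rowMin k m n (c ∘ avoidRow e) := by
  have hc' : ∀ f, 0 ≤ Function.update c e 0 f := by
    intro f
    by_cases h : f = e
    · subst h; simp
    · rw [Function.update_of_ne h]; exact hc f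
  refine le_antisymm ?_ ?_
  · obtain ⟨M, hM, heq⟩ := exists_setMin (exists_isRowMatching hm hn) (c ∘ avoidRow e)
    rw [rowMin, rowMin, heq]
    have h₁ : ∀ f ∈ M.map (avoidRow e), f.1 ≠ e.1 := by
      intro f hf
      obtain ⟨p, _, rfl⟩ := Finset.mem_map.1 hf
      exact Fin.succAbove_ne _ _
    have hins : IsRowMatching (k + 1) (m + 1) n (insert e (M.map (avoidRow e))) :=
      (hM.map _ _).insert h₁
    refine (setMin_le _ hins).trans_eq ?_
    rw [Finset.sum_insert fun h => h₁ e h rfl, Function.update_self, zero_add, Finset.sum_map]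
    refine Finset.sum_congr rfl fun p hp => ?_
    rw [Function.update_of_ne fun h => h₁ _ (Finset.mem_map_of_mem _ hp) (congrArg Prod.fst h)]
    rfl
  · obtain ⟨M, hM, heq⟩ := exists_setMin (exists_isRowMatching (Nat.succ_le_succ hm) hn)
      (Function.update c e 0)
    rw [rowMin, rowMin, heq]
    -- Drop the edge in the row of `e` if there is one, and otherwise any edge; costs are
    -- nonnegative.
    obtain ⟨f, hf, hfM⟩ : ∃ f ∈ M, ∀ g ∈ M.erase f, g.1 ≠ e.1 := by
      by_cases h : ∃ f ∈ M, f.1 = e.1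
      · obtain ⟨f, hf, hfe⟩ := h
        refine ⟨f, hf, fun g hg hge => ?_⟩
        exact hM.2 g (Finset.mem_of_mem_erase hg) f hf (Finset.ne_of_mem_erase hg)
          (hge.trans hfe.symm)
      · push Not at h
        obtain ⟨f, hf⟩ := Finset.card_pos.1 (hM.1 ▸ Nat.succ_pos k)
        exact ⟨f, hf, fun g hg => h g (Finset.mem_of_mem_erase hg)⟩
    obtain ⟨M', hM'⟩ : ∃ M' : Finset (Fin m × Fin n), M'.map (avoidRow e) = M.erase f := by
      refine ⟨(M.erase f).preimage (avoidRow e) (avoidRow e).injective.injOn, ?_⟩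
      ext g
      simp only [Finset.mem_map, Finset.mem_preimage]
      constructor
      · rintro ⟨p, hp, rfl⟩; exact hp
      · intro hg
        obtain ⟨i, hi⟩ := Fin.exists_succAbove_eq (hfM g hg)
        have : avoidRow e (i, g.2) = g := Prod.ext hi rfl
        exact ⟨(i, g.2), by rw [this]; exact hg, this⟩
    have hrow : IsRowMatching k (m + 1) n (M'.map (avoidRow e)) := by
      rw [hM']
      refine ⟨by rw [Finset.card_erase_of_mem hf, hM.1]; rfl, fun g hg g' hg' h => ?_⟩
      exact hM.2 g (Finset.mem_of_mem_erase hg) g' (Finset.mem_of_mem_erase hg') h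
    refine (setMin_le _ hrow.of_map).trans ?_
    have h1 : ∑ p ∈ M', (c ∘ avoidRow e) p = ∑ g ∈ M.erase f, Function.update c e 0 g := by
      rw [← hM', Finset.sum_map]
      refine Finset.sum_congr rfl fun p hp => ?_
      rw [Function.update_of_ne fun h => Fin.succAbove_ne e.1 p.1 (congrArg Prod.fst h)]
      rfl
    rw [h1]
    exact Finset.sum_le_sum_of_subset_of_nonneg (Finset.erase_subset _ _) fun g _ _ => hc' g

lemma minCost_comp_swap (k m n : ℕ) (c : Fin m × Fin n → ℝ) :
    minCost k n m (c ∘ Prod.swap) = minCost k m n c := by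
  have hswap : ∀ {m n : ℕ} {M : Finset (Fin m × Fin n)}, IsKMatching k m n M →
      IsKMatching k n m (M.map (Equiv.prodComm _ _).toEmbedding) := by
    intro m n M hM
    refine ⟨by rw [Finset.card_map, hM.1], fun e he f hf hef => ?_⟩
    obtain ⟨p, hp, rfl⟩ := Finset.mem_map.1 he
    obtain ⟨q, hq, rfl⟩ := Finset.mem_map.1 hf
    have hpq : p ≠ q := by rintro rfl; exact hef rfl
    exact (hM.2 p hp q hq hpq).symm
  let φ : {M // IsKMatching k m n M} ≃ {M // IsKMatching k n m M} :=
    { toFun := fun M => ⟨_, hswap M.2⟩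
      invFun := fun M => ⟨_, hswap M.2⟩
      left_inv := fun M => by
        apply Subtype.ext
        simp only [Finset.map_map]
        ext p
        simp
      right_inv := fun M => by
        apply Subtype.ext
        simp only [Finset.map_map]
        ext p
        simp }
  unfold minCost
  refine (φ.iInf_congr fun M => ?_).symm
  change ∑ e ∈ M.1.map (Equiv.prodComm _ _).toEmbedding, _ = _
  rw [Finset.sum_map]
  rfl

/-- Costs with a zero in each row of `R`, in column `j i` for the row `i`. -/
noncomputable def zeroRows {k n : ℕ} (R : Finset (Fin k)) (j : Fin k → Fin n)
    (c : Fin k × Fin n → ℝ) : Fin k × Fin n → ℝ :=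
  fun e => if e.1 ∈ R ∧ e.2 = j e.1 then 0 else c e

/-- With as many edges as rows, each row is used exactly once. Hence `setMin_add` applies to a
single row with `q = 1`. -/
lemma IsKMatching.card_inter_row {k n : ℕ} {M : Finset (Fin k × Fin n)} (hM : IsKMatching k k n M)
    (i : Fin k) : (M ∩ Finset.univ.filter fun e : Fin k × Fin n => e.1 = i).card = 1 := by
  have hinj : Set.InjOn Prod.fst (M : Set (Fin k × Fin n)) := by
    intro e he f hf hef
    by_contra h
    exact (hM.2 e he f hf h).1 hef
  have himg : M.image Prod.fst = Finset.univ := by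
    apply Finset.eq_univ_of_card
    rw [Finset.card_image_of_injOn hinj, hM.1, Fintype.card_fin]
  obtain ⟨e, he, hei⟩ := Finset.mem_image.1 (himg ▸ Finset.mem_univ i)
  refine Finset.card_eq_one.2 ⟨e, ?_⟩
  ext f
  simp only [Finset.mem_inter, Finset.mem_filter, Finset.mem_univ, true_and,
    Finset.mem_singleton]
  constructor
  · rintro ⟨hf, hfi⟩; exact hinj hf he (hfi.trans hei.symm)
  · rintro rfl; exact ⟨he, hei⟩

lemma minCost_zeroRows_of_injective {k n : ℕ} {j : Fin k → Fin n} (hj : Function.Injective j)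
    {c : Fin k × Fin n → ℝ} (hc : ∀ e, 0 ≤ c e) :
    minCost k k n (zeroRows Finset.univ j c) = 0 := by
  refine le_antisymm ?_ (setMin_nonneg fun e => ?_)
  · have hM : IsKMatching k k n (Finset.univ.image fun i => (i, j i)) := by
      refine ⟨?_, ?_⟩
      · rw [Finset.card_image_of_injective, Finset.card_univ, Fintype.card_fin]
        intro i i' h
        exact (Prod.mk.inj h).1
      · intro e he f hf hef
        simp only [Finset.mem_image, Finset.mem_univ, true_and] at he hf
        obtain ⟨i, rfl⟩ := he
        obtain ⟨i', rfl⟩ := hf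
        have hii : i ≠ i' := by rintro rfl; exact hef rfl
        exact ⟨hii, fun h => hii (hj h)⟩
    refine (setMin_le _ hM).trans_eq (Finset.sum_eq_zero fun e he => ?_)
    simp only [Finset.mem_image, Finset.mem_univ, true_and] at he
    obtain ⟨i, rfl⟩ := he
    simp [zeroRows]
  · unfold zeroRows
    split_ifs
    · exact le_rfl
    · exact hc e

/-- A matching of `k` edges misses one of the `k + 1` rows, and the zero of that row completes it,
since `σ` avoids all columns containing the chosen zeros. -/
lemma minCost_zeroRows_le {k n n' : ℕ} (hn : k ≤ n') (σ : Fin n' ↪ Fin n) (j : Fin (k + 1) → Fin n)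
    (hσ : ∀ i l, σ l ≠ j i) (c : Fin (k + 1) × Fin n → ℝ) :
    minCost (k + 1) (k + 1) n (zeroRows Finset.univ j c) ≤
      minCost k (k + 1) n' (c ∘ (Function.Embedding.refl _).prodMap σ) := by
  obtain ⟨M, hM, heq⟩ := exists_setMin (exists_isKMatching (Nat.le_succ k) hn)
    (c ∘ (Function.Embedding.refl _).prodMap σ)
  rw [minCost_eq_setMin, minCost_eq_setMin, heq]
  obtain ⟨i, hi⟩ : ∃ i, i ∉ M.image Prod.fst := by
    by_contra! h
    have h1 : (Finset.univ : Finset (Fin (k + 1))).card ≤ (M.image Prod.fst).card :=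
      Finset.card_le_card fun i _ => h i
    have h2 := Finset.card_image_le (s := M) (f := Prod.fst)
    rw [Finset.card_univ, Fintype.card_fin] at h1
    rw [hM.1] at h2
    omega
  have h₁ : ∀ f ∈ M.map ((Function.Embedding.refl _).prodMap σ), f.1 ≠ i := by
    rintro f hf rfl
    obtain ⟨p, hp, rfl⟩ := Finset.mem_map.1 hf
    exact hi (Finset.mem_image_of_mem _ hp)
  have h₂ : ∀ f ∈ M.map ((Function.Embedding.refl _).prodMap σ), f.2 ≠ j i := by
    intro f hf
    obtain ⟨p, hp, rfl⟩ := Finset.mem_map.1 hf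
    exact hσ _ _
  refine (setMin_le _ ((hM.map _ _).insert (e := (i, j i)) h₁ h₂)).trans_eq ?_
  rw [Finset.sum_insert fun h => h₁ _ h rfl, Finset.sum_map]
  have h0 : zeroRows Finset.univ j c (i, j i) = 0 := by simp [zeroRows]
  rw [h0, zero_add]
  refine Finset.sum_congr rfl fun p _ => ?_
  have := hσ p.1 p.2
  simp [zeroRows, this]

lemma measurable_minCost {k m n : ℕ} (hm : k ≤ m) (hn : k ≤ n) : Measurable (minCost k m n) :=
  measurable_setMin (exists_isKMatching hm hn)

lemma measurable_rowMin {k m n : ℕ} (hm : k ≤ m) (hn : 1 ≤ n) : Measurable (rowMin k m n) :=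
  measurable_setMin (exists_isRowMatching hm hn)

/-! ### Moment generating functions: rationality, upper bounds, row minima -/

/-- The moment generating function is rational. -/
theorem exists_isMomentGeneratingFunction {k m n : ℕ} (hm : k ≤ m) (hn : k ≤ n) :
    ∃ F : RatFunc ℂ, IsMomentGeneratingFunction k m n F := by
  classical
  obtain ⟨M₀, hM₀⟩ := exists_isKMatching hm hn
  have hs : (Finset.univ.filter (IsKMatching k m n)).Nonempty := ⟨M₀, by simpa using hM₀⟩
  -- The form `w` is the exponent of the exponential density, and `l M` is the cost of `M`.
  let w : Fin m × Fin n → ℝ := fun _ => 1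
  let l : Finset (Fin m × Fin n) → Fin m × Fin n → ℝ := fun M e => if e ∈ M then 1 else 0
  obtain ⟨F, hF⟩ := rationalIntegral w l _ hs
  have hform : ∀ t x, expMinForm w l _ hs t x =
      (ENNReal.ofReal (Real.exp (-∑ i, x i))).toReal •
        Complex.exp (t * (minCost k m n x : ℂ)) := by
    intro t x
    have h1 : (Finset.univ.filter (IsKMatching k m n)).inf' hs (fun M => ∑ i, l M i * x i) =
        minCost k m n x := by
      rw [minCost_eq_setMin, setMin_eq_inf' hs]
      simp [l, ite_mul]
    rw [expMinForm, h1, ENNReal.toReal_ofReal (Real.exp_pos _).le, Complex.real_smul,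
      Complex.ofReal_exp, ← Complex.exp_add]
    simp [w]
  refine ⟨F, fun t ht => ?_⟩
  rw [costMeasure_eq, expPi_eq_withDensity, integrable_withDensity_iff_integrable_smul'
    (by fun_prop) (by simp)] at ht
  have h2 := hF t (ht.congr (Filter.Eventually.of_forall fun x => (hform t x).symm))
  refine ⟨h2.1, h2.2.trans ?_⟩
  rw [complexMGF, costMeasure_eq, expPi_eq_withDensity,
    integral_withDensity_eq_integral_toReal_smul (by fun_prop) (by simp)]
  exact integral_congr_ae (Filter.Eventually.of_forall fun x => hform t x)

lemma integrable_cexp_of_lintegral {Ω : Type*} [MeasurableSpace Ω] {μ : Measure Ω} {X : Ω → ℝ}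
    (hX : Measurable X) {t : ℂ}
    (h : ∫⁻ ω, ENNReal.ofReal (Real.exp (t.re * X ω)) ∂μ < ∞) :
    Integrable (fun ω => Complex.exp (t * X ω)) μ := by
  refine ⟨by fun_prop, ?_⟩
  rw [hasFiniteIntegral_iff_norm]
  simpa only [Complex.norm_exp, Complex.re_mul_ofReal] using h

lemma integrable_exp_of_lintegral {Ω : Type*} [MeasurableSpace Ω] {μ : Measure Ω} {X : Ω → ℝ}
    (hX : Measurable X) {t : ℝ}
    (h : ∫⁻ ω, ENNReal.ofReal (Real.exp (t * X ω)) ∂μ < ∞) :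
    Integrable (fun ω => Real.exp (t * X ω)) μ := by
  refine ⟨by fun_prop, ?_⟩
  rw [hasFiniteIntegral_iff_norm]
  simpa only [Real.norm_eq_abs, Real.abs_exp] using h

lemma lintegral_exp_setMin_extract {ι : Type*} [Fintype ι] [DecidableEq ι] {P : Finset ι → Prop}
    (hP : ∃ M, P M) (A : Finset ι) (hA : A.Nonempty) (q : ℕ)
    (hq : ∀ M, P M → (M ∩ A).card = q) {τ : ℝ} (hτ : q * τ < A.card) :
    ∫⁻ x, ENNReal.ofReal (Real.exp (τ * setMin P x)) ∂(expPi ι) =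
      ENNReal.ofReal (1 / (A.card - q * τ)) *
        ∑ e ∈ A, ∫⁻ x, ENNReal.ofReal (Real.exp (τ * setMin P (Function.update x e 0)))
          ∂(expPi ι) := by
  have := measurable_setMin hP
  refine lintegral_expPi_extract A hA hτ (fun x => ENNReal.ofReal (Real.exp (τ * setMin P x)))
    (by fun_prop) fun x r => ?_
  rw [setMin_add hP A q hq, ← ENNReal.ofReal_mul (Real.exp_pos _).le, ← Real.exp_add]
  ring_nf

lemma integral_cexp_setMin_extract {ι : Type*} [Fintype ι] [DecidableEq ι] {P : Finset ι → Prop}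
    (hP : ∃ M, P M) (A : Finset ι) (hA : A.Nonempty) (q : ℕ)
    (hq : ∀ M, P M → (M ∩ A).card = q) {t : ℂ} (ht : q * t.re < A.card)
    (hint : Integrable (fun x => Complex.exp (t * setMin P x)) (expPi ι)) :
    ∫ x, Complex.exp (t * setMin P x) ∂(expPi ι) =
      1 / (A.card - q * t) *
        ∑ e ∈ A, ∫ x, Complex.exp (t * setMin P (Function.update x e 0)) ∂(expPi ι) := by
  have := measurable_setMin hP
  refine integral_expPi_extract A hA (z := q * t) (by simpa using ht)
    (fun x => Complex.exp (t * setMin P x)) (by fun_prop) hint fun x r => ?_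
  rw [setMin_add hP A q hq, ← Complex.exp_add]
  push_cast
  ring_nf

/-- The moment generating function of the greedy `k`-matching. -/
noncomputable def greedyMGF (k m n : ℕ) (τ : ℝ) : ℝ :=
  ∏ j ∈ Finset.range k, (1 - τ * (k - j) / ((m - j) * (n - j)))⁻¹

/-- The moment generating function of `rowMin k m n`. -/
noncomputable def rowMGF (k m n : ℕ) (t : ℂ) : ℂ :=
  ∏ j ∈ Finset.range k, (1 - t * (k - j) / ((m - j) * n))⁻¹

lemma greedyMGF_succ (k m n : ℕ) (τ : ℝ) :
    greedyMGF (k + 1) (m + 1) (n + 1) τ =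
      (1 - τ * (k + 1) / ((m + 1) * (n + 1)))⁻¹ * greedyMGF k m n τ := by
  unfold greedyMGF
  rw [Finset.prod_range_succ', mul_comm]
  congr 1
  · simp
  · refine Finset.prod_congr rfl fun j _ => ?_
    push_cast
    ring_nf

lemma rowMGF_succ (k m n : ℕ) (t : ℂ) :
    rowMGF (k + 1) (m + 1) n t = (1 - t * (k + 1) / ((m + 1) * n))⁻¹ * rowMGF k m n t := by
  unfold rowMGF
  rw [Finset.prod_range_succ', mul_comm]
  congr 1
  · simp
  · refine Finset.prod_congr rfl fun j _ => ?_
    push_cast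
    ring_nf

lemma lintegral_comp_embedding {ι κ : Type*} [Fintype ι] [Fintype κ] (σ : κ ↪ ι)
    {f : (κ → ℝ) → ℝ≥0∞} (hf : Measurable f) :
    ∫⁻ x, f (x ∘ σ) ∂(expPi ι) = ∫⁻ x, f x ∂(expPi κ) :=
  (measurePreserving_expPi_comp σ σ.injective).lintegral_comp hf

lemma lintegral_minCost_zero (m n : ℕ) (τ : ℝ) :
    ∫⁻ x, ENNReal.ofReal (Real.exp (τ * minCost 0 m n x)) ∂(expPi (Fin m × Fin n)) = 1 := by
  have h : ∀ x, minCost 0 m n x = 0 := by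
    intro x
    obtain ⟨M, hM, heq⟩ := exists_setMin (exists_isKMatching (Nat.zero_le m) (Nat.zero_le n)) x
    rw [minCost_eq_setMin, heq, Finset.card_eq_zero.1 hM.1, Finset.sum_empty]
  simp [h]

lemma rowMin_zero {m n : ℕ} (hn : 1 ≤ n) (x : Fin m × Fin n → ℝ) : rowMin 0 m n x = 0 := by
  obtain ⟨M, hM, heq⟩ := exists_setMin (exists_isRowMatching (Nat.zero_le m) hn) x
  rw [rowMin, heq, Finset.card_eq_zero.1 hM.1, Finset.sum_empty]

lemma lintegral_exp_minCost_update_le {k m n : ℕ} (hm : k ≤ m) (hn : k ≤ n) {τ : ℝ} (hτ : 0 ≤ τ)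
    (e : Fin (m + 1) × Fin (n + 1)) :
    ∫⁻ x, ENNReal.ofReal (Real.exp (τ * minCost (k + 1) (m + 1) (n + 1) (Function.update x e 0)))
      ∂(expPi (Fin (m + 1) × Fin (n + 1))) ≤
    ∫⁻ x, ENNReal.ofReal (Real.exp (τ * minCost k m n x)) ∂(expPi (Fin m × Fin n)) := by
  have := measurable_minCost hm hn
  rw [← lintegral_comp_embedding (avoidEdge e)
    (f := fun x => ENNReal.ofReal (Real.exp (τ * minCost k m n x))) (by fun_prop)]
  exact lintegral_mono fun x => ENNReal.ofReal_le_ofReal <| Real.exp_le_exp.2 <|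
    mul_le_mul_of_nonneg_left (minCost_update_le hm hn e x) hτ

lemma IsKMatching.card_inter_univ {k m n : ℕ} {M : Finset (Fin m × Fin n)}
    (h : IsKMatching k m n M) : (M ∩ Finset.univ).card = k := by
  rw [Finset.inter_univ, h.1]

lemma IsRowMatching.card_inter_univ {k m n : ℕ} {M : Finset (Fin m × Fin n)}
    (h : IsRowMatching k m n M) : (M ∩ Finset.univ).card = k := by
  rw [Finset.inter_univ, h.1]

/-- Splitting off the overall minimum gives one factor, and `minCost_update_le` passes to a matrix
with one row and one column fewer. The hypothesis `h` keeps the denominators of all the successive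
factors positive. -/
lemma lintegral_exp_minCost_le {k m n : ℕ} (hm : k ≤ m) (hn : k ≤ n) {τ : ℝ} (hτ : 0 ≤ τ)
    (h : ∀ j < k, τ * (k - j) < (m - j : ℝ) * (n - j)) :
    ∫⁻ x, ENNReal.ofReal (Real.exp (τ * minCost k m n x)) ∂(expPi (Fin m × Fin n)) ≤
      ENNReal.ofReal (greedyMGF k m n τ) := by
  induction k generalizing m n with
  | zero => rw [lintegral_minCost_zero]; simp [greedyMGF]
  | succ k ih =>
    obtain ⟨m, rfl⟩ := Nat.exists_eq_add_of_lt hm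
    obtain ⟨n, rfl⟩ := Nat.exists_eq_add_of_lt hn
    have hm' : k ≤ k + m := Nat.le_add_right k m
    have hn' : k ≤ k + n := Nat.le_add_right k n
    generalize k + m = m at *
    generalize k + n = n at *
    have h0 := h 0 (Nat.succ_pos k)
    push_cast at h0
    simp only [sub_zero] at h0
    have hcard : ((Finset.univ : Finset (Fin (m + 1) × Fin (n + 1))).card : ℝ) =
        (m + 1) * (n + 1) := by
      simp
    have hih := ih hm' hn' fun j hj => by
      have := h (j + 1) (Nat.succ_lt_succ hj)
      push_cast at this
      simpa using this
    rw [minCost_eq_setMin, lintegral_exp_setMin_extract (exists_isKMatching hm hn) Finset.univ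
      Finset.univ_nonempty (k + 1) (fun M hM => hM.card_inter_univ)
      (by rw [hcard]; push_cast; linarith), greedyMGF_succ]
    have hpos : 0 < (1 - τ * (k + 1) / ((m + 1) * (n + 1) : ℝ)) := by
      rw [sub_pos, div_lt_one (by positivity)]; exact h0
    calc _ ≤ ENNReal.ofReal (1 / ((m + 1) * (n + 1) - (k + 1) * τ)) *
          ∑ e : Fin (m + 1) × Fin (n + 1), ENNReal.ofReal (greedyMGF k m n τ) := by
          rw [hcard]
          push_cast
          gcongr with e _
          exact (lintegral_exp_minCost_update_le hm' hn' hτ e).trans hih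
      _ = _ := by
          rw [Finset.sum_const, nsmul_eq_mul, ← mul_assoc, ← ENNReal.ofReal_natCast, hcard,
            ← ENNReal.ofReal_mul, ENNReal.ofReal_mul (inv_pos.2 hpos).le]
          · congr 2
            have : (m + 1 : ℝ) * (n + 1) - (k + 1) * τ ≠ 0 := by linarith
            field_simp
          · exact one_div_nonneg.2 (by linarith)

lemma lintegral_exp_rowMin_update {k m n : ℕ} (hm : k ≤ m) (hn : 1 ≤ n) (τ : ℝ)
    (e : Fin (m + 1) × Fin n) :
    ∫⁻ x, ENNReal.ofReal (Real.exp (τ * rowMin (k + 1) (m + 1) n (Function.update x e 0)))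
      ∂(expPi (Fin (m + 1) × Fin n)) =
    ∫⁻ x, ENNReal.ofReal (Real.exp (τ * rowMin k m n x)) ∂(expPi (Fin m × Fin n)) := by
  have := measurable_rowMin hm hn
  rw [← lintegral_comp_embedding (avoidRow e)
    (f := fun x => ENNReal.ofReal (Real.exp (τ * rowMin k m n x))) (by fun_prop)]
  refine lintegral_congr_ae ?_
  filter_upwards [ae_expPi_pos] with x hx
  rw [rowMin_update hm hn e fun f => (hx f).le]

lemma integral_cexp_rowMin_update {k m n : ℕ} (hm : k ≤ m) (hn : 1 ≤ n) (t : ℂ)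
    (e : Fin (m + 1) × Fin n) :
    ∫ x, Complex.exp (t * rowMin (k + 1) (m + 1) n (Function.update x e 0))
      ∂(expPi (Fin (m + 1) × Fin n)) =
    ∫ x, Complex.exp (t * rowMin k m n x) ∂(expPi (Fin m × Fin n)) := by
  have := measurable_rowMin hm hn
  have hf : Measurable fun x => Complex.exp (t * rowMin k m n x) := by fun_prop
  have hσ := measurePreserving_expPi_comp (avoidRow e) (avoidRow e).injective
  rw [← hσ.map_eq, integral_map hσ.aemeasurable hf.aestronglyMeasurable]
  refine integral_congr_ae ?_
  filter_upwards [ae_expPi_pos] with x hx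
  rw [rowMin_update hm hn e fun f => (hx f).le]

lemma lintegral_exp_rowMin_lt_top {k m n : ℕ} (hm : k ≤ m) (hn : 1 ≤ n) {τ : ℝ}
    (h : ∀ j < k, τ * (k - j) < (m - j : ℝ) * n) :
    ∫⁻ x, ENNReal.ofReal (Real.exp (τ * rowMin k m n x)) ∂(expPi (Fin m × Fin n)) < ∞ := by
  induction k generalizing m with
  | zero => simp [rowMin_zero hn]
  | succ k ih =>
    obtain ⟨m, rfl⟩ := Nat.exists_eq_add_of_lt hm
    have hm' : k ≤ k + m := Nat.le_add_right k m
    generalize k + m = m at *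
    have h0 := h 0 (Nat.succ_pos k)
    push_cast at h0
    simp only [sub_zero] at h0
    have hcard : ((Finset.univ : Finset (Fin (m + 1) × Fin n)).card : ℝ) = (m + 1) * n := by
      simp
    have hih := ih hm' fun j hj => by
      have := h (j + 1) (Nat.succ_lt_succ hj)
      push_cast at this
      simpa using this
    have : NeZero n := ⟨by omega⟩
    rw [rowMin, lintegral_exp_setMin_extract (exists_isRowMatching hm hn) Finset.univ
      Finset.univ_nonempty (k + 1) (fun M hM => hM.card_inter_univ)
      (by rw [hcard]; push_cast; linarith)]
    refine ENNReal.mul_lt_top ENNReal.ofReal_lt_top (ENNReal.sum_lt_top.2 fun e _ => ?_)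
    exact (lintegral_exp_rowMin_update hm' hn τ e).trans_lt hih

/-- The same recursion as for matchings, but exact: removing a zero entry deletes its row and keeps
all `n` columns. -/
lemma integral_cexp_rowMin {k m n : ℕ} (hm : k ≤ m) (hn : 1 ≤ n) {t : ℂ}
    (h : ∀ j < k, t.re * (k - j) < (m - j : ℝ) * n) :
    ∫ x, Complex.exp (t * rowMin k m n x) ∂(expPi (Fin m × Fin n)) = rowMGF k m n t := by
  induction k generalizing m with
  | zero => simp [rowMin_zero hn, rowMGF]
  | succ k ih =>
    have hfin := lintegral_exp_rowMin_lt_top hm hn h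
    obtain ⟨m, rfl⟩ := Nat.exists_eq_add_of_lt hm
    have hm' : k ≤ k + m := Nat.le_add_right k m
    generalize k + m = m at *
    have h0 := h 0 (Nat.succ_pos k)
    push_cast at h0
    simp only [sub_zero] at h0
    have hcard : ((Finset.univ : Finset (Fin (m + 1) × Fin n)).card : ℝ) = (m + 1) * n := by
      simp
    have hcardC : ((Finset.univ : Finset (Fin (m + 1) × Fin n)).card : ℂ) = (m + 1) * n := by
      simp
    have hih := ih hm' fun j hj => by
      have := h (j + 1) (Nat.succ_lt_succ hj)
      push_cast at this
      simpa using this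
    have : NeZero n := ⟨by omega⟩
    have hint := integrable_cexp_of_lintegral (measurable_rowMin hm hn) hfin
    rw [rowMin, integral_cexp_setMin_extract (exists_isRowMatching hm hn) Finset.univ
      Finset.univ_nonempty (k + 1) (fun M hM => hM.card_inter_univ)
      (by rw [hcard]; push_cast; linarith) hint]
    have hsum : ∀ e : Fin (m + 1) × Fin n, ∫ x, Complex.exp (t * setMin (IsRowMatching (k + 1)
        (m + 1) n) (Function.update x e 0)) ∂(expPi (Fin (m + 1) × Fin n)) = rowMGF k m n t :=
      fun e => (integral_cexp_rowMin_update hm' hn t e).trans hih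
    rw [Finset.sum_congr rfl fun e _ => hsum e, Finset.sum_const, nsmul_eq_mul, ← mul_assoc,
      hcardC, rowMGF_succ]
    congr 1
    have h1 : ((m + 1) * n - (k + 1) * t : ℂ) ≠ 0 := by
      intro h
      have := congrArg Complex.re h
      simp at this
      linarith
    have h2 : ((m + 1) * n : ℂ) ≠ 0 := by
      have : (n : ℂ) ≠ 0 := Nat.cast_ne_zero.2 (by omega)
      exact mul_ne_zero (by exact_mod_cast Nat.succ_ne_zero m) this
    have h3 : (1 - t * (k + 1) / ((m + 1) * n) : ℂ) = ((m + 1) * n - (k + 1) * t) / ((m + 1) * n) := by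
      rw [sub_div, div_self h2]; ring
    push_cast
    rw [h3, inv_div]
    ring

/-! ### A criterion for nonvanishing: comparison with row minima -/

/-- The expectation of `exp (t * minCost k m n)` converges and is nonzero in the closed disk of
radius `m * n / k`, apart from the point `m * n / k`. -/
def NonvanishingMGF (k m n : ℕ) : Prop :=
  ∀ t : ℂ, ‖t‖ ≤ (m : ℝ) * n / k → t ≠ ((m * n / k : ℝ) : ℂ) →
    Integrable (fun c => Complex.exp (t * (minCost k m n c : ℂ))) (costMeasure m n) ∧
      complexMGF (minCost k m n) (costMeasure m n) t ≠ 0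

/-- The line `re = τ` touches the closed disk of radius `τ` only at `τ`. -/
lemma re_lt_of_norm_le {t : ℂ} {τ : ℝ} (h : ‖t‖ ≤ τ) (hne : t ≠ (τ : ℂ)) : t.re < τ := by
  refine lt_of_le_of_ne ((Complex.re_le_norm t).trans h) fun hre => hne ?_
  have h0 : 0 ≤ τ := (norm_nonneg t).trans h
  have h1 : t.re ^ 2 + t.im ^ 2 ≤ τ ^ 2 := by
    have h2 : ‖t‖ ^ 2 ≤ τ ^ 2 := pow_le_pow_left₀ (norm_nonneg t) h 2
    rw [Complex.sq_norm, Complex.normSq_apply] at h2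
    nlinarith
  have him : t.im = 0 := by
    rw [hre] at h1
    exact pow_eq_zero_iff two_ne_zero |>.1 (le_antisymm (by linarith) (sq_nonneg _))
  exact Complex.ext (by simpa using hre) (by simpa using him)

/-- Factor out the exponential at `a` and use `‖exp z - 1‖ ≥ 0` together with `‖exp z - 1‖ ≤ exp ‖z‖
- 1`. Comparisons on the disk thus reduce to the real point `τ`. -/
lemma norm_cexp_sub_cexp_le {t : ℂ} {τ a b : ℝ} (ht : ‖t‖ ≤ τ) (ha : 0 ≤ a) (hab : a ≤ b) :
    ‖Complex.exp (t * b) - Complex.exp (t * a)‖ ≤ Real.exp (τ * b) - Real.exp (τ * a) := by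
  have h1 : Complex.exp (t * b) - Complex.exp (t * a) =
      Complex.exp (t * a) * (Complex.exp (t * (b - a)) - 1) := by
    rw [mul_sub, ← Complex.exp_add]; ring_nf
  have h2 : Real.exp (τ * b) - Real.exp (τ * a) =
      Real.exp (τ * a) * (Real.exp (τ * (b - a)) - 1) := by
    rw [mul_sub, ← Real.exp_add]; ring_nf
  rw [h1, h2, norm_mul]
  refine mul_le_mul ?_ ?_ (norm_nonneg _) (Real.exp_pos _).le
  · rw [Complex.norm_exp, Complex.re_mul_ofReal]
    exact Real.exp_le_exp.2 (mul_le_mul_of_nonneg_right ((Complex.re_le_norm t).trans ht) ha)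
  · have h3 : ‖Complex.exp (t * (b - a)) - 1‖ ≤ Real.exp ‖t * (b - a : ℂ)‖ - 1 := by
      have := Complex.norm_exp_sub_sum_le_exp_norm_sub_sum (t * (b - a)) 1
      simpa using this
    refine h3.trans (sub_le_sub_right (Real.exp_le_exp.2 ?_) 1)
    rw [norm_mul, ← Complex.ofReal_sub, Complex.norm_real, Real.norm_eq_abs,
      abs_of_nonneg (sub_nonneg.2 hab)]
    exact mul_le_mul_of_nonneg_right ht (sub_nonneg.2 hab)

lemma integrable_cexp_mul_of_re_le {ι : Type*} [Fintype ι] {X : (ι → ℝ) → ℝ} (hX : Measurable X)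
    (hpos : ∀ c, (∀ i, 0 ≤ c i) → 0 ≤ X c) {t : ℂ} {τ : ℝ} (ht : t.re ≤ τ)
    (h : ∫⁻ c, ENNReal.ofReal (Real.exp (τ * X c)) ∂(expPi ι) < ∞) :
    Integrable (fun c => Complex.exp (t * X c)) (expPi ι) := by
  refine integrable_cexp_of_lintegral hX (lt_of_le_of_lt (lintegral_mono_ae ?_) h)
  filter_upwards [ae_expPi_pos] with c hc
  exact ENNReal.ofReal_le_ofReal <| Real.exp_le_exp.2 <|
    mul_le_mul_of_nonneg_right ht (hpos c fun i => (hc i).le)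

lemma update_zero_nonneg {ι : Type*} [DecidableEq ι] {c : ι → ℝ} (hc : ∀ i, 0 ≤ c i) (e i : ι) :
    0 ≤ Function.update c e 0 i := by
  by_cases h : i = e
  · subst h; simp
  · rw [Function.update_of_ne h]; exact hc i

/-- After zeroing `e`, the row minimum is at most the matching cost, so the complex difference is
bounded by the difference of the real expectations at `τ`. The greedy product bounds the larger of
these, and the smaller is known exactly. -/
lemma norm_integral_minCost_sub_rowMin_le {k m n : ℕ} (hm : k ≤ m) (hn : k ≤ n)
    (e : Fin (m + 1) × Fin (n + 1)) {t : ℂ} {τ : ℝ} (ht : ‖t‖ ≤ τ)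
    (h : ∀ j < k, τ * (k - j) < (m - j : ℝ) * (n - j)) :
    ‖∫ x, Complex.exp (t * minCost (k + 1) (m + 1) (n + 1) (Function.update x e 0))
        ∂(expPi (Fin (m + 1) × Fin (n + 1))) - rowMGF k m (n + 1) t‖ ≤
      greedyMGF k m n τ - (rowMGF k m (n + 1) τ).re := by
  have hτ : 0 ≤ τ := (norm_nonneg t).trans ht
  have hrow : ∀ {s : ℝ}, s ≤ τ → ∀ j < k, s * (k - j) < (m - j : ℝ) * ((n + 1 : ℕ) : ℝ) := by
    intro s hs j hj
    have hjk : (j : ℝ) < k := by exact_mod_cast hj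
    have hjm : (j : ℝ) ≤ m := by exact_mod_cast hj.le.trans hm
    have hj0 : (0 : ℝ) ≤ j := Nat.cast_nonneg j
    have := h j hj
    push_cast
    nlinarith
  set C : (Fin (m + 1) × Fin (n + 1) → ℝ) → ℝ := fun x =>
    minCost (k + 1) (m + 1) (n + 1) (Function.update x e 0) with hC
  set S : (Fin (m + 1) × Fin (n + 1) → ℝ) → ℝ := fun x =>
    rowMin (k + 1) (m + 1) (n + 1) (Function.update x e 0) with hS
  have hu : Measurable fun x : Fin (m + 1) × Fin (n + 1) → ℝ => Function.update x e 0 := by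
    fun_prop
  have hCm : Measurable C :=
    (measurable_minCost (Nat.succ_le_succ hm) (Nat.succ_le_succ hn)).comp hu
  have hSm : Measurable S :=
    (measurable_rowMin (Nat.succ_le_succ hm) (Nat.succ_le_succ (Nat.zero_le n))).comp hu
  have hn1 : 1 ≤ n + 1 := Nat.succ_le_succ (Nat.zero_le n)
  have hC0 : ∀ c : Fin (m + 1) × Fin (n + 1) → ℝ, (∀ i, 0 ≤ c i) → 0 ≤ C c := fun c hc =>
    setMin_nonneg (update_zero_nonneg hc e)
  have hS0 : ∀ c : Fin (m + 1) × Fin (n + 1) → ℝ, (∀ i, 0 ≤ c i) → 0 ≤ S c := fun c hc =>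
    setMin_nonneg (update_zero_nonneg hc e)
  have hCle : ∫⁻ x, ENNReal.ofReal (Real.exp (τ * C x))
      ∂(expPi (Fin (m + 1) × Fin (n + 1))) ≤ ENNReal.ofReal (greedyMGF k m n τ) :=
    (lintegral_exp_minCost_update_le hm hn hτ e).trans (lintegral_exp_minCost_le hm hn hτ h)
  have hCfin := hCle.trans_lt ENNReal.ofReal_lt_top
  have hSfin : ∫⁻ x, ENNReal.ofReal (Real.exp (τ * S x))
      ∂(expPi (Fin (m + 1) × Fin (n + 1))) < ∞ := by
    rw [hS, lintegral_exp_rowMin_update hm hn1]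
    exact lintegral_exp_rowMin_lt_top hm hn1 (hrow le_rfl)
  have htre : t.re ≤ τ := (Complex.re_le_norm t).trans ht
  have hCt := integrable_cexp_mul_of_re_le hCm hC0 htre hCfin
  have hSt := integrable_cexp_mul_of_re_le hSm hS0 htre hSfin
  have hCτ := integrable_exp_of_lintegral hCm hCfin
  have hSτ := integrable_exp_of_lintegral hSm hSfin
  have hSval : ∀ s : ℂ, s.re ≤ τ → ∫ x, Complex.exp (s * S x)
      ∂(expPi (Fin (m + 1) × Fin (n + 1))) = rowMGF k m (n + 1) s := by
    intro s hs
    rw [hS, integral_cexp_rowMin_update hm hn1, integral_cexp_rowMin hm hn1 (hrow hs)]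
  have hSreal : ∫ x, Real.exp (τ * S x) ∂(expPi (Fin (m + 1) × Fin (n + 1))) =
      (rowMGF k m (n + 1) τ).re := by
    rw [← hSval τ (by simp)]
    have : ∀ x, Complex.exp (τ * S x) = ((Real.exp (τ * S x) : ℝ) : ℂ) := by
      intro x; push_cast; rfl
    simp_rw [this]
    rw [integral_complex_ofReal, Complex.ofReal_re]
  have hgreedy : 0 ≤ greedyMGF k m n τ := by
    refine Finset.prod_nonneg fun j hj => inv_nonneg.2 (sub_nonneg.2 ?_)
    have hj := Finset.mem_range.1 hj
    have hjm : (0 : ℝ) < m - j := sub_pos.2 (by exact_mod_cast hj.trans_le hm)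
    have hjn : (0 : ℝ) < n - j := sub_pos.2 (by exact_mod_cast hj.trans_le hn)
    rw [div_le_one (mul_pos hjm hjn)]
    exact (h j hj).le
  have hCreal : ∫ x, Real.exp (τ * C x) ∂(expPi (Fin (m + 1) × Fin (n + 1))) ≤
      greedyMGF k m n τ := by
    rw [integral_eq_lintegral_of_nonneg_ae
      (Filter.Eventually.of_forall fun x => (Real.exp_pos _).le) hCτ.aestronglyMeasurable]
    exact ENNReal.toReal_le_of_le_ofReal hgreedy hCle
  rw [← hSval t htre, ← integral_sub hCt hSt]
  calc _ ≤ ∫ x, (Real.exp (τ * C x) - Real.exp (τ * S x))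
        ∂(expPi (Fin (m + 1) × Fin (n + 1))) := by
        refine norm_integral_le_of_norm_le (hCτ.sub hSτ) ?_
        filter_upwards [ae_expPi_pos] with x hx
        exact norm_cexp_sub_cexp_le ht (hS0 x fun i => (hx i).le)
          (rowMin_le_minCost (Nat.succ_le_succ hm) (Nat.succ_le_succ hn) _)
    _ = ∫ x, Real.exp (τ * C x) ∂(expPi (Fin (m + 1) × Fin (n + 1))) -
        ∫ x, Real.exp (τ * S x) ∂(expPi (Fin (m + 1) × Fin (n + 1))) := integral_sub hCτ hSτ
    _ ≤ _ := by rw [hSreal]; linarith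

/-- Comparison with the row minima excludes zeros. -/
lemma nonvanishingMGF_of_greedyMGF {k m n : ℕ} (hm : k ≤ m) (hn : k ≤ n)
    (h : ∀ j < k, (m + 1 : ℝ) * (n + 1) / (k + 1) * (k - j) < (m - j : ℝ) * (n - j))
    (hclose : ∀ t : ℂ, ‖t‖ ≤ (m + 1 : ℝ) * (n + 1) / (k + 1) →
      greedyMGF k m n ((m + 1 : ℝ) * (n + 1) / (k + 1)) -
        (rowMGF k m (n + 1) (((m + 1 : ℝ) * (n + 1) / (k + 1) : ℝ) : ℂ)).re <
      ‖rowMGF k m (n + 1) t‖) :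
    NonvanishingMGF (k + 1) (m + 1) (n + 1) := by
  intro t ht hne
  push_cast at ht
  have hm' := Nat.succ_le_succ hm
  have hn' := Nat.succ_le_succ hn
  set τ : ℝ := (m + 1 : ℝ) * (n + 1) / (k + 1) with hτ
  have hτ0 : 0 < τ := by positivity
  have hτk : τ * (k + 1) = (m + 1) * (n + 1) := by rw [hτ]; field_simp
  have hre : t.re < τ := re_lt_of_norm_le ht (by push_cast at hne ⊢; rw [hτ]; push_cast; exact hne)
  have hint : Integrable (fun c => Complex.exp (t * (minCost (k + 1) (m + 1) (n + 1) c : ℂ)))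
      (expPi (Fin (m + 1) × Fin (n + 1))) := by
    -- The greedy bound needs a nonnegative parameter strictly below the radius: at the radius its
    -- factor for `j = 0` has denominator zero.
    refine integrable_cexp_mul_of_re_le (τ := max t.re 0) (measurable_minCost hm' hn')
      (fun c hc => setMin_nonneg hc) (le_max_left _ _)
      ((lintegral_exp_minCost_le hm' hn' (le_max_right _ _) fun j hj => ?_).trans_lt
        ENNReal.ofReal_lt_top)
    have hmax : max t.re 0 < τ := max_lt hre hτ0
    cases j with
    | zero =>
      push_cast
      rw [sub_zero, sub_zero, sub_zero, ← hτk]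
      exact mul_lt_mul_of_pos_right hmax (by positivity)
    | succ j =>
      have hj' := Nat.lt_of_succ_lt_succ hj
      have hjk : (j : ℝ) < k := by exact_mod_cast hj'
      have := h j hj'
      push_cast
      nlinarith
  refine ⟨hint, ?_⟩
  have hcard : ((Finset.univ : Finset (Fin (m + 1) × Fin (n + 1))).card : ℝ) =
      (m + 1) * (n + 1) := by simp
  have hcardC : ((Finset.univ : Finset (Fin (m + 1) × Fin (n + 1))).card : ℂ) =
      (m + 1) * (n + 1) := by simp
  have hext := integral_cexp_setMin_extract (exists_isKMatching hm' hn') Finset.univ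
    Finset.univ_nonempty (k + 1) (fun M hM => hM.card_inter_univ) (t := t)
    (by rw [hcard, ← hτk]; push_cast; rw [mul_comm]; gcongr) hint
  rw [complexMGF, costMeasure_eq, minCost_eq_setMin, hext]
  refine mul_ne_zero (one_div_ne_zero ?_) fun hsum => ?_
  · intro h0
    have h1 := congrArg Complex.re h0
    rw [hcardC] at h1
    simp at h1
    nlinarith
  -- If the sum vanished, the differences from `rowMGF` would add up to minus the number of edges
  -- times `rowMGF`, against the bound for each difference and `hclose`.
  · have hdiff := Finset.sum_sub_distrib (s := (Finset.univ :
      Finset (Fin (m + 1) × Fin (n + 1)))) (f := fun e => ∫ x, Complex.exp (t *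
        setMin (IsKMatching (k + 1) (m + 1) (n + 1)) (Function.update x e 0))
          ∂(expPi (Fin (m + 1) × Fin (n + 1)))) (g := fun _ => rowMGF k m (n + 1) t)
    rw [hsum, zero_sub, Finset.sum_const, nsmul_eq_mul] at hdiff
    have hle := norm_sum_le (Finset.univ : Finset (Fin (m + 1) × Fin (n + 1)))
      (fun e => ∫ x, Complex.exp (t *
        setMin (IsKMatching (k + 1) (m + 1) (n + 1)) (Function.update x e 0))
          ∂(expPi (Fin (m + 1) × Fin (n + 1))) - rowMGF k m (n + 1) t)
    rw [hdiff, norm_neg, norm_mul, hcardC] at hle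
    have hle2 := hle.trans (Finset.sum_le_sum fun e _ =>
      norm_integral_minCost_sub_rowMin_le hm hn e ht h)
    rw [Finset.sum_const, nsmul_eq_mul, hcard] at hle2
    have hnorm : ‖((m + 1) * (n + 1) : ℂ)‖ = (m + 1) * (n + 1) := by
      rw [show ((m + 1) * (n + 1) : ℂ) = (((m + 1) * (n + 1) : ℝ) : ℂ) by push_cast; rfl,
        Complex.norm_real, Real.norm_of_nonneg (by positivity)]
    rw [hnorm] at hle2
    have := le_of_mul_le_mul_left hle2 (by positivity)
    exact absurd (hclose t ht) (not_lt.2 this)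

/-! ### Uniform estimates when a row is left over -/

section Estimates

variable {k m n j : ℕ}

/-- After `n + 1` cancels, the quantity is `(m + 1) * (k - j) / ((k + 1) * (m - j))`. It would equal
1 for `m = k`; for `m > k` it stays away from 1 by a margin depending on `k` alone. -/
lemma row_factor_bounds (hm : k < m) (hj : j < k) :
    0 ≤ (m + 1 : ℝ) * (n + 1) / (k + 1) * (k - j) / ((m - j) * (n + 1)) ∧
      (m + 1 : ℝ) * (n + 1) / (k + 1) * (k - j) / ((m - j) * (n + 1)) ≤
        1 - 1 / (k + 1 : ℝ) ^ 2 := by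
  have hjk : (j : ℝ) + 1 ≤ k := by exact_mod_cast hj
  have hkm : (k : ℝ) + 1 ≤ m := by exact_mod_cast hm
  have hj0 : (0 : ℝ) ≤ j := Nat.cast_nonneg j
  have hmj : 0 < (m - j : ℝ) := by linarith
  have heq : (m + 1 : ℝ) * (n + 1) / (k + 1) * (k - j) / ((m - j) * (n + 1)) =
      (m + 1) * (k - j) / ((k + 1) * (m - j)) := by
    field_simp
  rw [heq]
  refine ⟨div_nonneg (mul_nonneg (by positivity) (by linarith)) (by positivity), ?_⟩
  have h1 : 1 - 1 / (k + 1 : ℝ) ^ 2 - (m + 1) * (k - j) / ((k + 1) * (m - j)) =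
      ((k + 1) * (j + 1) * (m - k) - (m - j)) / ((k + 1) ^ 2 * (m - j)) := by
    field_simp
    ring
  have h2 : 0 ≤ ((k + 1) * (j + 1) * (m - k) - (m - j) : ℝ) := by
    have h3 : (k + 1 : ℝ) * (m - k) ≤ (k + 1) * (j + 1) * (m - k) := by
      refine mul_le_mul_of_nonneg_right ?_ (by linarith)
      nlinarith
    nlinarith
  have h4 : 0 ≤ ((k + 1) * (j + 1) * (m - k) - (m - j) : ℝ) / ((k + 1) ^ 2 * (m - j)) :=
    div_nonneg h2 (by positivity)
  linarith

/-- Replacing `n + 1` by `n - j` in the denominator raises the row term `a` by `a * (j + 1) / (n -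
j) ≤ (k + 1) / (n - k)`. Since `1 - a ≥ 1 / (k + 1) ^ 2`, this is a relative error of at most `(k +
1) ^ 3 / (n - k)`. -/
lemma greedy_factor_ge (hm : k < m) (hn : k < n) (hj : j < k) :
    (1 - (m + 1 : ℝ) * (n + 1) / (k + 1) * (k - j) / ((m - j) * (n + 1))) *
        (1 - (k + 1 : ℝ) ^ 3 / (n - k)) ≤
      1 - (m + 1 : ℝ) * (n + 1) / (k + 1) * (k - j) / ((m - j) * (n - j)) := by
  obtain ⟨ha0, ha1⟩ := row_factor_bounds (n := n) hm hj
  have hjk : (j : ℝ) + 1 ≤ k := by exact_mod_cast hj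
  have hkm : (k : ℝ) + 1 ≤ m := by exact_mod_cast hm
  have hkn : (k : ℝ) + 1 ≤ n := by exact_mod_cast hn
  have hj0 : (0 : ℝ) ≤ j := Nat.cast_nonneg j
  have hmj : 0 < (m - j : ℝ) := by linarith
  have hnj : 0 < (n - j : ℝ) := by linarith
  have hnk : 0 < (n - k : ℝ) := by linarith
  have hb : (m + 1 : ℝ) * (n + 1) / (k + 1) * (k - j) / ((m - j) * (n - j)) =
      (m + 1 : ℝ) * (n + 1) / (k + 1) * (k - j) / ((m - j) * (n + 1)) +
        (m + 1 : ℝ) * (n + 1) / (k + 1) * (k - j) / ((m - j) * (n + 1)) *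
          ((j + 1) / (n - j)) := by
    field_simp
    ring
  rw [hb]
  set a := (m + 1 : ℝ) * (n + 1) / (k + 1) * (k - j) / ((m - j) * (n + 1))
  have h1 : (j + 1 : ℝ) / (n - j) ≤ (k + 1) / (n - k) := by
    gcongr
  have h2 : a * ((j + 1 : ℝ) / (n - j)) ≤ (k + 1) / (n - k) := by
    have h3 : a ≤ 1 := ha1.trans (by linarith [show 0 ≤ 1 / (k + 1 : ℝ) ^ 2 by positivity])
    have h4 : 0 ≤ (j + 1 : ℝ) / (n - j) := by positivity
    nlinarith
  have h3 : (k + 1 : ℝ) / (n - k) ≤ (1 - a) * ((k + 1 : ℝ) ^ 3 / (n - k)) := by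
    have h4 : (k + 1 : ℝ) / (n - k) = 1 / (k + 1 : ℝ) ^ 2 * ((k + 1 : ℝ) ^ 3 / (n - k)) := by
      field_simp
    rw [h4]
    exact mul_le_mul_of_nonneg_right (by linarith) (by positivity)
  nlinarith

/-- Each factor is the inverse of `1 - z` with `‖z‖ < 1`, hence of a nonzero number of norm at most
2. -/
lemma one_half_pow_le_norm_rowMGF (hm : k < m) {t : ℂ}
    (ht : ‖t‖ ≤ (m + 1 : ℝ) * (n + 1) / (k + 1)) : (1 / 2 : ℝ) ^ k ≤ ‖rowMGF k m (n + 1) t‖ := by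
  rw [rowMGF, norm_prod]
  have : (1 / 2 : ℝ) ^ k = ∏ _j ∈ Finset.range k, (1 / 2 : ℝ) := by simp
  rw [this]
  refine Finset.prod_le_prod (fun _ _ => by norm_num) fun j hj => ?_
  have hj := Finset.mem_range.1 hj
  obtain ⟨-, ha1⟩ := row_factor_bounds (n := n) hm hj
  have hjk : (0 : ℝ) < k - j := sub_pos.2 (by exact_mod_cast hj)
  have hmj : (0 : ℝ) < m - j := sub_pos.2 (by exact_mod_cast hj.trans hm)
  have hz : ‖t * (k - j) / ((m - j) * ((n + 1 : ℕ) : ℂ))‖ < 1 := by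
    have h1 : ‖((k - j) / ((m - j) * ((n + 1 : ℕ) : ℂ)) : ℂ)‖ = (k - j) / ((m - j) * (n + 1)) := by
      rw [show ((k - j) / ((m - j) * ((n + 1 : ℕ) : ℂ)) : ℂ) =
        (((k - j) / ((m - j) * (n + 1)) : ℝ) : ℂ) by push_cast; rfl, Complex.norm_real,
        Real.norm_of_nonneg (by positivity)]
    rw [mul_div_assoc, norm_mul, h1]
    calc _ ≤ (m + 1 : ℝ) * (n + 1) / (k + 1) * ((k - j) / ((m - j) * (n + 1))) := by gcongr
      _ = (m + 1 : ℝ) * (n + 1) / (k + 1) * (k - j) / ((m - j) * (n + 1)) := by ring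
      _ ≤ 1 - 1 / (k + 1 : ℝ) ^ 2 := ha1
      _ < 1 := by linarith [show 0 < 1 / (k + 1 : ℝ) ^ 2 by positivity]
  rw [norm_inv, one_div]
  have hlow := norm_sub_norm_le (1 : ℂ) (t * (k - j) / ((m - j) * ((n + 1 : ℕ) : ℂ)))
  have hup := norm_sub_le (1 : ℂ) (t * (k - j) / ((m - j) * ((n + 1 : ℕ) : ℂ)))
  rw [norm_one] at hlow hup
  exact inv_anti₀ (by linarith) (by linarith)

/-- The row product is at most `((k + 1) ^ 2) ^ k`, and the greedy product exceeds it by at most the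
factor `(1 - η)⁻¹ ^ k`. Neither bound involves `m`. -/
lemma greedyMGF_sub_rowMGF_le (hm : k < m) (hn : k < n)
    (hη : (k + 1 : ℝ) ^ 3 / (n - k) < 1) :
    greedyMGF k m n ((m + 1 : ℝ) * (n + 1) / (k + 1)) -
        (rowMGF k m (n + 1) (((m + 1 : ℝ) * (n + 1) / (k + 1) : ℝ) : ℂ)).re ≤
      ((k + 1 : ℝ) ^ 2) ^ k * (((1 - (k + 1 : ℝ) ^ 3 / (n - k))⁻¹) ^ k - 1) := by
  set η := (k + 1 : ℝ) ^ 3 / (n - k) with hηdef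
  have hkn : (0 : ℝ) < n - k := sub_pos.2 (by exact_mod_cast hn)
  have hη0 : 0 ≤ η := by positivity
  set a : ℕ → ℝ := fun j => (m + 1 : ℝ) * (n + 1) / (k + 1) * (k - j) / ((m - j) * (n + 1)) with ha
  have hrow : rowMGF k m (n + 1) (((m + 1 : ℝ) * (n + 1) / (k + 1) : ℝ) : ℂ) =
      ((∏ j ∈ Finset.range k, (1 - a j)⁻¹ : ℝ) : ℂ) := by
    simp only [rowMGF, ha]
    push_cast
    rfl
  have hδ : ∀ j ∈ Finset.range k, 1 / (k + 1 : ℝ) ^ 2 ≤ 1 - a j := fun j hj => by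
    have := (row_factor_bounds (n := n) hm (Finset.mem_range.1 hj)).2
    simp only [ha]; linarith
  have hδ0 : 0 < 1 / (k + 1 : ℝ) ^ 2 := by positivity
  have hR : ∏ j ∈ Finset.range k, (1 - a j)⁻¹ ≤ ((k + 1 : ℝ) ^ 2) ^ k := by
    have : ((k + 1 : ℝ) ^ 2) ^ k = ∏ _j ∈ Finset.range k, (k + 1 : ℝ) ^ 2 := by simp
    rw [this]
    refine Finset.prod_le_prod (fun j hj => inv_nonneg.2 (hδ0.le.trans (hδ j hj))) fun j hj => ?_
    have := inv_anti₀ hδ0 (hδ j hj)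
    simpa using this
  have hG : greedyMGF k m n ((m + 1 : ℝ) * (n + 1) / (k + 1)) ≤
      (∏ j ∈ Finset.range k, (1 - a j)⁻¹) * ((1 - η)⁻¹) ^ k := by
    have : ((1 - η)⁻¹) ^ k = ∏ _j ∈ Finset.range k, (1 - η)⁻¹ := by simp
    rw [this, ← Finset.prod_mul_distrib, greedyMGF]
    have hpos : ∀ j ∈ Finset.range k, 0 < (1 - a j) * (1 - η) := fun j hj =>
      mul_pos (hδ0.trans_le (hδ j hj)) (by linarith)
    have hge : ∀ j ∈ Finset.range k, (1 - a j) * (1 - η) ≤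
        1 - (m + 1 : ℝ) * (n + 1) / (k + 1) * (k - j) / ((m - j) * (n - j)) := fun j hj =>
      greedy_factor_ge hm hn (Finset.mem_range.1 hj)
    refine Finset.prod_le_prod (fun j hj => inv_nonneg.2 ((hpos j hj).le.trans (hge j hj)))
      fun j hj => ?_
    rw [← mul_inv]
    exact inv_anti₀ (hpos j hj) (hge j hj)
  rw [hrow, Complex.ofReal_re]
  have h1 : 1 ≤ ((1 - η)⁻¹) ^ k :=
    one_le_pow₀ ((one_le_inv₀ (by linarith)).2 (by linarith))
  nlinarith

end Estimates

lemma tendsto_div_sub_const (a b : ℝ) :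
    Filter.Tendsto (fun n : ℕ => a / ((n : ℝ) - b)) Filter.atTop (nhds 0) :=
  tendsto_const_nhds.div_atTop
    (Filter.tendsto_atTop_add_const_right _ (-b) tendsto_natCast_atTop_atTop)

/-- For matchings that leave out some row there are no zeros if there are many columns. -/
theorem eventually_nonvanishingMGF_of_lt (k : ℕ) : ∀ᶠ n : ℕ in Filter.atTop, ∀ m, k < m →
    NonvanishingMGF (k + 1) (m + 1) (n + 1) := by
  have hη := tendsto_div_sub_const ((k + 1 : ℝ) ^ 3) k
  have hlim : Filter.Tendsto (fun n : ℕ =>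
      ((k + 1 : ℝ) ^ 2) ^ k * (((1 - (k + 1 : ℝ) ^ 3 / (n - k))⁻¹) ^ k - 1))
      Filter.atTop (nhds 0) := by
    have h1 := ((((tendsto_const_nhds (x := (1 : ℝ))).sub hη).inv₀ (by simp)).pow k).sub
      (tendsto_const_nhds (x := (1 : ℝ)))
    simpa using h1.const_mul (((k + 1 : ℝ) ^ 2) ^ k)
  -- These conditions on `n` do not mention `m`, which gives uniformity over all `m > k`.
  filter_upwards [hη.eventually_lt_const one_pos,
    hlim.eventually_lt_const (show (0 : ℝ) < (1 / 2) ^ k by positivity),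
    Filter.eventually_gt_atTop k] with n h1 h2 hn m hm
  refine nonvanishingMGF_of_greedyMGF hm.le hn.le (fun j hj => ?_) fun t ht => ?_
  · have hjm : (0 : ℝ) < m - j := sub_pos.2 (by exact_mod_cast hj.trans hm)
    have hjn : (0 : ℝ) < n - j := sub_pos.2 (by exact_mod_cast hj.trans hn)
    have h3 := greedy_factor_ge hm hn hj
    have h4 := (row_factor_bounds (n := n) hm hj).2
    have h5 : 0 < 1 / (k + 1 : ℝ) ^ 2 := by positivity
    have h6 := mul_pos (show 0 < 1 - (m + 1 : ℝ) * (n + 1) / (k + 1) * (k - j) /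
      ((m - j) * (n + 1)) by linarith) (sub_pos.2 h1)
    have h7 := sub_pos.1 (h6.trans_le h3)
    rwa [div_lt_one (mul_pos hjm hjn)] at h7
  · exact (greedyMGF_sub_rowMGF_le hm hn h1).trans_lt
      (h2.trans_le (one_half_pow_le_norm_rowMGF hm ht))

/-! ### Matchings that use every row: one zero in each row -/

section ZeroRows

variable {k n : ℕ}

/-- The edges in row `i`. -/
def row (k n : ℕ) (i : Fin k) : Finset (Fin k × Fin n) :=
  Finset.univ.filter fun e => e.1 = i

lemma sum_row {α : Type*} [AddCommMonoid α] (i : Fin k) (f : Fin k × Fin n → α) :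
    ∑ e ∈ row k n i, f e = ∑ l, f (i, l) := by
  rw [row, Finset.sum_filter, Fintype.sum_prod_type, Finset.sum_comm]
  simp

lemma card_row (i : Fin k) : (row k n i).card = n := by
  rw [Finset.card_eq_sum_ones, sum_row]
  simp

lemma zeroRows_add {R : Finset (Fin k)} {i : Fin k} (hi : i ∉ R) (j : Fin k → Fin n)
    (c : Fin k × Fin n → ℝ) (r : ℝ) :
    zeroRows R j (fun f => c f + r * (if f ∈ row k n i then 1 else 0)) =
      fun f => zeroRows R j c f + r * (if f ∈ row k n i then 1 else 0) := by
  ext f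
  unfold zeroRows
  by_cases h : f.1 ∈ R ∧ f.2 = j f.1
  · have hfi : f.1 ≠ i := fun h' => hi (h' ▸ h.1)
    simp [h, row, hfi]
  · simp only [h, if_false]

lemma zeroRows_update {R : Finset (Fin k)} {i : Fin k} (hi : i ∉ R) (j : Fin k → Fin n)
    (l : Fin n) (c : Fin k × Fin n → ℝ) :
    zeroRows R j (Function.update c (i, l) 0) =
      zeroRows (insert i R) (Function.update j i l) c := by
  ext ⟨a, b⟩
  by_cases ha : a = i
  · subst ha
    by_cases hb : b = l
    · subst hb; simp [zeroRows, hi]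
    · simp [zeroRows, hi, hb]
  · simp [zeroRows, ha]

lemma zeroRows_empty (j : Fin k → Fin n) (c : Fin k × Fin n → ℝ) : zeroRows ∅ j c = c := by
  ext e; simp [zeroRows]

lemma measurable_zeroRows (R : Finset (Fin k)) (j : Fin k → Fin n) :
    Measurable (zeroRows R j) := by
  refine measurable_pi_lambda _ fun e => ?_
  by_cases h : e.1 ∈ R ∧ e.2 = j e.1
  · simp only [zeroRows, h, and_self, if_true]; exact measurable_const
  · simp only [zeroRows, h, if_false]; exact measurable_pi_apply e

lemma zeroRows_nonneg (R : Finset (Fin k)) (j : Fin k → Fin n) {c : Fin k × Fin n → ℝ}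
    (hc : ∀ e, 0 ≤ c e) (e : Fin k × Fin n) : 0 ≤ zeroRows R j c e := by
  unfold zeroRows
  split_ifs
  · exact le_rfl
  · exact hc e

lemma minCost_zeroRows_le_minCost (hn : k ≤ n) (R : Finset (Fin k)) (j : Fin k → Fin n)
    {c : Fin k × Fin n → ℝ} (hc : ∀ e, 0 ≤ c e) :
    minCost k k n (zeroRows R j c) ≤ minCost k k n c := by
  obtain ⟨M, hM, heq⟩ := exists_setMin (exists_isKMatching le_rfl hn) c
  rw [minCost_eq_setMin, heq]
  refine (setMin_le _ hM).trans (Finset.sum_le_sum fun e _ => ?_)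
  unfold zeroRows
  split_ifs
  · exact hc e
  · exact le_rfl

/-- Changing one value of a function: each function arises `n` times. -/
lemma sum_sum_update {α : Type*} [AddCommMonoid α] (i : Fin k) (F : (Fin k → Fin n) → α) :
    ∑ j : Fin k → Fin n, ∑ l : Fin n, F (Function.update j i l) = n • ∑ j, F j := by
  let φ : (Fin k → Fin n) × Fin n ≃ (Fin k → Fin n) × Fin n :=
    { toFun := fun p => (Function.update p.1 i p.2, p.1 i)
      invFun := fun p => (Function.update p.1 i p.2, p.1 i)
      left_inv := fun p => by simp
      right_inv := fun p => by simp }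
  rw [← Fintype.sum_prod_type' (f := fun j l => F (Function.update j i l)),
    Fintype.sum_equiv φ (fun p => F (Function.update p.1 i p.2)) (fun p => F p.1) fun p => rfl,
    Fintype.sum_prod_type]
  simp [Finset.smul_sum]

/-- Row by row, splitting off the minimum of row `i` gives `1 / (n - τ)` and a sum over the column
of its zero. Summing over all functions `j`, also outside `R`, makes each choice recur `n` times,
whence `n / (n - τ)`. No finiteness is assumed, so this identity can be used to prove convergence.
-/
lemma sum_lintegral_zeroRows (hn : k ≤ n) (R : Finset (Fin k)) {τ : ℝ} (hτ : τ < n) :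
    ∑ _j : Fin k → Fin n, ∫⁻ c, ENNReal.ofReal (Real.exp (τ * minCost k k n c))
        ∂(expPi (Fin k × Fin n)) =
      ENNReal.ofReal (n / (n - τ)) ^ R.card * ∑ j : Fin k → Fin n,
        ∫⁻ c, ENNReal.ofReal (Real.exp (τ * minCost k k n (zeroRows R j c)))
          ∂(expPi (Fin k × Fin n)) := by
  induction R using Finset.induction_on with
  | empty => simp [zeroRows_empty]
  | insert i R hi ih =>
    rw [ih, Finset.card_insert_of_notMem hi, pow_succ, mul_assoc]
    congr 1
    have hC := measurable_minCost le_rfl hn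
    have hstep : ∀ j : Fin k → Fin n,
        ∫⁻ c, ENNReal.ofReal (Real.exp (τ * minCost k k n (zeroRows R j c)))
          ∂(expPi (Fin k × Fin n)) = ENNReal.ofReal (1 / (n - τ)) * ∑ l : Fin n,
        ∫⁻ c, ENNReal.ofReal (Real.exp (τ * minCost k k n
          (zeroRows (insert i R) (Function.update j i l) c))) ∂(expPi (Fin k × Fin n)) := by
      intro j
      have hz := measurable_zeroRows R j
      have hcomp := hC.comp hz
      have hne : (row k n i).Nonempty :=
        Finset.card_pos.1 (by rw [card_row]; exact i.pos.trans_le hn)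
      have hext := lintegral_expPi_extract (row k n i) hne (z := τ) (by rw [card_row]; exact hτ)
        (fun c => ENNReal.ofReal (Real.exp (τ * minCost k k n (zeroRows R j c))))
        (by unfold Function.comp at hcomp; fun_prop) fun c r => by
          rw [zeroRows_add hi, minCost_eq_setMin, setMin_add (exists_isKMatching le_rfl hn)
            (row k n i) 1 (fun M hM => hM.card_inter_row i),
            ← ENNReal.ofReal_mul (Real.exp_pos _).le, ← Real.exp_add]
          push_cast
          ring_nf
      rw [hext, card_row, sum_row]
      simp only [zeroRows_update hi]
    simp_rw [hstep]
    rw [← Finset.mul_sum, sum_sum_update i fun j => ∫⁻ c, ENNReal.ofReal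
      (Real.exp (τ * minCost k k n (zeroRows (insert i R) j c))) ∂(expPi (Fin k × Fin n)),
      nsmul_eq_mul, ← mul_assoc, ← ENNReal.ofReal_natCast, ← ENNReal.ofReal_mul
        (one_div_nonneg.2 (by linarith)), one_div_mul_eq_div]

lemma sum_integral_zeroRows (hn : k ≤ n) (R : Finset (Fin k)) {t : ℂ} (ht : t.re < n)
    (hint : ∀ (R : Finset (Fin k)) (j : Fin k → Fin n), Integrable
      (fun c => Complex.exp (t * minCost k k n (zeroRows R j c))) (expPi (Fin k × Fin n))) :
    ∑ _j : Fin k → Fin n, ∫ c, Complex.exp (t * minCost k k n c) ∂(expPi (Fin k × Fin n)) =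
      (n / (n - t)) ^ R.card * ∑ j : Fin k → Fin n,
        ∫ c, Complex.exp (t * minCost k k n (zeroRows R j c)) ∂(expPi (Fin k × Fin n)) := by
  induction R using Finset.induction_on with
  | empty => simp [zeroRows_empty]
  | insert i R hi ih =>
    rw [ih, Finset.card_insert_of_notMem hi, pow_succ, mul_assoc]
    congr 1
    have hC := measurable_minCost le_rfl hn
    have hstep : ∀ j : Fin k → Fin n,
        ∫ c, Complex.exp (t * minCost k k n (zeroRows R j c)) ∂(expPi (Fin k × Fin n)) =
        1 / (n - t) * ∑ l : Fin n, ∫ c, Complex.exp (t * minCost k k n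
          (zeroRows (insert i R) (Function.update j i l) c)) ∂(expPi (Fin k × Fin n)) := by
      intro j
      have hz := measurable_zeroRows R j
      have hcomp := hC.comp hz
      have hne : (row k n i).Nonempty :=
        Finset.card_pos.1 (by rw [card_row]; exact i.pos.trans_le hn)
      have hext := integral_expPi_extract (row k n i) hne (z := t) (by rw [card_row]; exact ht)
        (fun c => Complex.exp (t * minCost k k n (zeroRows R j c)))
        (by unfold Function.comp at hcomp; fun_prop) (hint R j) fun c r => by
          rw [zeroRows_add hi, minCost_eq_setMin, setMin_add (exists_isKMatching le_rfl hn)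
            (row k n i) 1 (fun M hM => hM.card_inter_row i), ← Complex.exp_add]
          push_cast
          ring_nf
      rw [hext, card_row, sum_row]
      simp only [zeroRows_update hi]
    simp_rw [hstep]
    rw [← Finset.mul_sum, sum_sum_update i fun j => ∫ c, Complex.exp
      (t * minCost k k n (zeroRows (insert i R) j c)) ∂(expPi (Fin k × Fin n)),
      nsmul_eq_mul, ← mul_assoc, one_div_mul_eq_div]

end ZeroRows

section SquareEstimates

/-- With ε = 1/(2(k+1)), the lower bound on `n` gives n ≤ (1+ε)(n-(k+1)-j), while (k-j)(1+ε) ≤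
(1-ε)(k+1-j); multiplying them leaves the margin ε. -/
lemma square_factor_ge {k n j : ℕ} (hj : j < k) (hn : 2 * (k + 1) + 4 * (k + 1) ^ 2 ≤ n) :
    1 / (2 * (k + 1) : ℝ) ≤ 1 - n * (k - j) / (((k + 1 : ℕ) - j) * ((n - (k + 1) : ℕ) - j)) := by
  have hjk : (j : ℝ) + 1 ≤ k := by exact_mod_cast hj
  have hj0 : (0 : ℝ) ≤ j := Nat.cast_nonneg j
  have hn' : 2 * (k + 1) + 4 * (k + 1 : ℝ) ^ 2 ≤ n := by exact_mod_cast hn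
  rw [Nat.cast_sub (by nlinarith)]
  push_cast
  have h1 : (0 : ℝ) < k + 1 - j := by linarith
  have h2 : (0 : ℝ) < n - (k + 1) - j := by nlinarith
  rw [le_sub_iff_add_le', ← le_sub_iff_add_le, div_le_iff₀ (mul_pos h1 h2)]
  have hk1 : (0 : ℝ) < k + 1 := by linarith
  have h3 : (n : ℝ) ≤ (1 + 1 / (2 * (k + 1))) * (n - (k + 1) - j) := by
    have : 1 / (2 * (k + 1)) * (2 * (k + 1)) = (1 : ℝ) := by field_simp
    have hp : (0 : ℝ) < 1 / (2 * (k + 1)) := by positivity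
    have h5 : 1 / (2 * (k + 1)) * (4 * (k + 1 : ℝ) ^ 2) = 2 * (k + 1) := by field_simp; ring
    have h6 : 1 / (2 * (k + 1)) * (4 * (k + 1 : ℝ) ^ 2) ≤
        1 / (2 * (k + 1)) * (n - (k + 1) - j) :=
      mul_le_mul_of_nonneg_left (by linarith) hp.le
    nlinarith
  have h4 : (k - j : ℝ) * (1 + 1 / (2 * (k + 1))) ≤ (1 - 1 / (2 * (k + 1))) * (k + 1 - j) := by
    have : 0 ≤ (1 - 1 / (2 * (k + 1))) * (k + 1 - j) - (k - j : ℝ) * (1 + 1 / (2 * (k + 1))) := by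
      have : (1 - 1 / (2 * (k + 1))) * (k + 1 - j) - (k - j : ℝ) * (1 + 1 / (2 * (k + 1))) =
          (2 * j + 1) / (2 * (k + 1)) := by
        field_simp
        ring
      rw [this]
      positivity
    linarith
  calc (n : ℝ) * (k - j) ≤ (1 + 1 / (2 * (k + 1))) * (n - (k + 1) - j) * (k - j) :=
        mul_le_mul_of_nonneg_right h3 (by linarith)
    _ = (k - j : ℝ) * (1 + 1 / (2 * (k + 1))) * (n - (k + 1) - j) := by ring
    _ ≤ (1 - 1 / (2 * (k + 1))) * (k + 1 - j) * (n - (k + 1) - j) :=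
        mul_le_mul_of_nonneg_right h4 h2.le
    _ = _ := by ring

/-- The parameter is the full radius `n`; it is admissible because only `k` of the `k + 1` rows have
to be matched. -/
lemma lintegral_exp_submatrix_le {k n : ℕ} (hn : 2 * (k + 1) + 4 * (k + 1) ^ 2 ≤ n) :
    ∫⁻ x, ENNReal.ofReal (Real.exp (n * minCost k (k + 1) (n - (k + 1)) x))
      ∂(expPi (Fin (k + 1) × Fin (n - (k + 1)))) ≤ ENNReal.ofReal ((2 * (k + 1)) ^ k) := by
  have hle : k ≤ n - (k + 1) := by
    apply Nat.le_sub_of_add_le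
    nlinarith
  refine (lintegral_exp_minCost_le (Nat.le_succ k) hle (Nat.cast_nonneg n) fun j hj => ?_).trans
    (ENNReal.ofReal_le_ofReal ?_)
  · have h := square_factor_ge hj hn
    have h0 : (0 : ℝ) < 1 / (2 * (k + 1)) := by positivity
    have h1 : (0 : ℝ) < (k + 1 : ℕ) - j := sub_pos.2 (by exact_mod_cast hj.trans (Nat.lt_succ_self k))
    have h2 : (0 : ℝ) < (n - (k + 1) : ℕ) - j := sub_pos.2 (by exact_mod_cast hj.trans_le hle)
    have h3 := sub_pos.1 (h0.trans_le h)
    rwa [div_lt_one (mul_pos h1 h2)] at h3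
  · have : ((2 * (k + 1)) ^ k : ℝ) = ∏ _j ∈ Finset.range k, (2 * (k + 1) : ℝ) := by simp
    rw [this, greedyMGF]
    have h0 : (0 : ℝ) < 1 / (2 * (k + 1)) := by positivity
    refine Finset.prod_le_prod (fun j hj => inv_nonneg.2
      (h0.le.trans (square_factor_ge (Finset.mem_range.1 hj) hn))) fun j hj => ?_
    have h := inv_anti₀ h0 (square_factor_ge (Finset.mem_range.1 hj) hn)
    rwa [one_div, inv_inv] at h

/-- The injective functions number at least `(n - k) ^ k`, which by Bernoulli is at least `n ^ k *
(1 - k ^ 2 / n)`. -/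
lemma card_not_injective_le (k n : ℕ) (hkn : k ≤ n) :
    ((Finset.univ.filter fun j : Fin k → Fin n => ¬ Function.Injective j).card : ℝ) * n ≤
      (k : ℝ) ^ 2 * n ^ k := by
  have hinj : (Finset.univ.filter fun j : Fin k → Fin n => Function.Injective j).card =
      n.descFactorial k := by
    have h1 := Fintype.card_embedding_eq (α := Fin k) (β := Fin n)
    rw [Fintype.card_fin, Fintype.card_fin] at h1
    rw [← h1, ← Fintype.card_subtype]
    exact Fintype.card_congr (Equiv.subtypeInjectiveEquivEmbedding _ _)
  have htot := Finset.card_filter_add_card_filter_not (s := (Finset.univ : Finset (Fin k → Fin n)))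
    (fun j => Function.Injective j)
  rw [hinj, Finset.card_univ, Fintype.card_fun, Fintype.card_fin, Fintype.card_fin] at htot
  have htot' : ((n.descFactorial k : ℕ) : ℝ) + ((Finset.univ.filter
      fun j : Fin k → Fin n => ¬ Function.Injective j).card : ℝ) = (n : ℝ) ^ k := by
    exact_mod_cast htot
  rcases Nat.eq_zero_or_pos n with rfl | hn0
  · simp
    positivity
  have hnpos : (0 : ℝ) < n := by exact_mod_cast hn0
  have hdesc : ((n - k : ℝ)) ^ k ≤ (n.descFactorial k : ℕ) := by
    have h1 : (n - k) ^ k ≤ n.descFactorial k :=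
      (Nat.pow_le_pow_left (by omega) k).trans (Nat.pow_sub_le_descFactorial n k)
    have h2 : (((n - k) ^ k : ℕ) : ℝ) ≤ (n.descFactorial k : ℕ) := by exact_mod_cast h1
    rwa [Nat.cast_pow, Nat.cast_sub hkn] at h2
  have hbern : (n : ℝ) ^ k * (1 - k * (k / n)) ≤ (n - k : ℝ) ^ k := by
    have hkn' : (k : ℝ) / n ≤ 1 := (div_le_one hnpos).2 (by exact_mod_cast hkn)
    have h1 := one_add_mul_le_pow (a := -((k : ℝ) / n)) (by linarith) k
    have h2 : (n - k : ℝ) = n * (1 + -(k / n)) := by field_simp; ring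
    rw [h2, mul_pow]
    exact mul_le_mul_of_nonneg_left (by linarith) (by positivity)
  have h3 : (n : ℝ) ^ k * (1 - k * (k / n)) * n = n ^ k * n - k ^ 2 * n ^ k := by
    field_simp
  have h4 := mul_le_mul_of_nonneg_right (hbern.trans hdesc) hnpos.le
  rw [h3] at h4
  nlinarith

end SquareEstimates

/-- If `‖t‖ ≤ n` then the zeros given to the rows hardly change the expectation from `1`. -/
lemma norm_integral_zeroRows_sub_one_le {k n : ℕ} (hn : 2 * (k + 1) + 4 * (k + 1) ^ 2 ≤ n)
    (j : Fin (k + 1) → Fin n) {t : ℂ} (ht : ‖t‖ ≤ n) :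
    (∫⁻ c, ENNReal.ofReal (Real.exp (n * minCost (k + 1) (k + 1) n (zeroRows Finset.univ j c)))
        ∂(expPi (Fin (k + 1) × Fin n)) < ∞) ∧
      ‖∫ c, Complex.exp (t * minCost (k + 1) (k + 1) n (zeroRows Finset.univ j c))
        ∂(expPi (Fin (k + 1) × Fin n)) - 1‖ ≤
        if Function.Injective j then 0 else (2 * (k + 1) : ℝ) ^ k := by
  have hkn : k + 1 ≤ n := by nlinarith
  have hCm : Measurable fun c => minCost (k + 1) (k + 1) n (zeroRows Finset.univ j c) :=
    (measurable_minCost le_rfl hkn).comp (measurable_zeroRows _ j)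
  by_cases hj : Function.Injective j
  · have hzero : ∀ᵐ c ∂(expPi (Fin (k + 1) × Fin n)),
        minCost (k + 1) (k + 1) n (zeroRows Finset.univ j c) = 0 := by
      filter_upwards [ae_expPi_pos] with c hc
      exact minCost_zeroRows_of_injective hj fun e => (hc e).le
    refine ⟨?_, ?_⟩
    · have : ∀ᵐ c ∂(expPi (Fin (k + 1) × Fin n)), ENNReal.ofReal (Real.exp
          (n * minCost (k + 1) (k + 1) n (zeroRows Finset.univ j c))) = 1 := by
        filter_upwards [hzero] with c hc
        simp [hc]
      rw [lintegral_congr_ae this]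
      simp
    · have : ∀ᵐ c ∂(expPi (Fin (k + 1) × Fin n)), Complex.exp
          (t * minCost (k + 1) (k + 1) n (zeroRows Finset.univ j c)) = 1 := by
        filter_upwards [hzero] with c hc
        simp [hc]
      rw [integral_congr_ae this]
      simp [hj]
  · have hle : k ≤ n - (k + 1) := by
      apply Nat.le_sub_of_add_le
      nlinarith
    have hcard : n - (k + 1) ≤ (Finset.univ \ Finset.univ.image j).card := by
      rw [Finset.card_sdiff_of_subset (Finset.subset_univ _), Finset.card_univ, Fintype.card_fin]
      have h := Finset.card_image_le (s := (Finset.univ : Finset (Fin (k + 1)))) (f := j)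
      rw [Finset.card_univ, Fintype.card_fin] at h
      omega
    -- Columns containing none of the chosen zeros; at most `k + 1` columns are excluded.
    let σ : Fin (n - (k + 1)) ↪ Fin n :=
      ((Finset.univ \ Finset.univ.image j).orderEmbOfCardLe hcard).toEmbedding
    have hσ : ∀ i l, σ l ≠ j i := by
      intro i l h
      have h1 := Finset.orderEmbOfCardLe_mem (Finset.univ \ Finset.univ.image j) hcard l
      exact (Finset.mem_sdiff.1 h1).2 (Finset.mem_image.2 ⟨i, Finset.mem_univ i, h.symm⟩)
    have hC' := measurable_minCost (Nat.le_succ k) hle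
    have hbound : ∫⁻ c, ENNReal.ofReal
        (Real.exp (n * minCost (k + 1) (k + 1) n (zeroRows Finset.univ j c)))
        ∂(expPi (Fin (k + 1) × Fin n)) ≤ ENNReal.ofReal ((2 * (k + 1)) ^ k) := by
      refine le_trans ?_ (lintegral_exp_submatrix_le hn)
      rw [← lintegral_comp_embedding ((Function.Embedding.refl (Fin (k + 1))).prodMap σ)
        (f := fun x => ENNReal.ofReal (Real.exp (n * minCost k (k + 1) (n - (k + 1)) x)))
        (by fun_prop)]
      exact lintegral_mono fun c => ENNReal.ofReal_le_ofReal <| Real.exp_le_exp.2 <|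
        mul_le_mul_of_nonneg_left (minCost_zeroRows_le hle σ j hσ c) (Nat.cast_nonneg n)
    have hfin := hbound.trans_lt ENNReal.ofReal_lt_top
    refine ⟨hfin, ?_⟩
    have hreal := integrable_exp_of_lintegral hCm hfin
    have hcplx : Integrable (fun c => Complex.exp (t *
        minCost (k + 1) (k + 1) n (zeroRows Finset.univ j c)))
        (expPi (Fin (k + 1) × Fin n)) :=
      integrable_cexp_mul_of_re_le hCm
        (fun c hc => setMin_nonneg (zeroRows_nonneg _ j hc)) ((Complex.re_le_norm t).trans ht) hfin
    have hone : ∫ _ : Fin (k + 1) × Fin n → ℝ, (1 : ℂ) ∂(expPi (Fin (k + 1) × Fin n)) = 1 := by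
      simp
    rw [if_neg hj]
    have hsub := integral_sub hcplx (integrable_const 1)
    rw [hone] at hsub
    rw [← hsub]
    calc _ ≤ ∫ c, Real.exp (n * minCost (k + 1) (k + 1) n (zeroRows Finset.univ j c))
          ∂(expPi (Fin (k + 1) × Fin n)) := by
          refine norm_integral_le_of_norm_le hreal ?_
          filter_upwards [ae_expPi_pos] with c hc
          -- Comparison with cost 0 gives `‖exp (t * C) - 1‖ ≤ exp (n * C) - 1`, and the `-1` is
          -- dropped.
          have h := norm_cexp_sub_cexp_le ht le_rfl
            (setMin_nonneg (P := IsKMatching (k + 1) (k + 1) n)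
              (zeroRows_nonneg Finset.univ j fun e => (hc e).le))
          simp only [Complex.ofReal_zero, mul_zero, Complex.exp_zero, Real.exp_zero] at h
          rw [minCost_eq_setMin]
          linarith
      _ ≤ _ := by
          rw [integral_eq_lintegral_of_nonneg_ae
            (Filter.Eventually.of_forall fun x => (Real.exp_pos _).le) hreal.aestronglyMeasurable]
          exact ENNReal.toReal_le_of_le_ofReal (by positivity) hbound

/-- For matchings that use all rows there are no zeros if there are many columns. -/
theorem eventually_nonvanishingMGF_self (k : ℕ) :
    ∀ᶠ n : ℕ in Filter.atTop, NonvanishingMGF (k + 1) (k + 1) n := by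
  filter_upwards [Filter.eventually_ge_atTop (2 * (k + 1) + 4 * (k + 1) ^ 2),
    tendsto_natCast_atTop_atTop.eventually_gt_atTop
      (((k + 1 : ℕ) : ℝ) ^ 2 * (2 * (k + 1)) ^ k)] with n hn hlarge
  intro t ht hne
  have hkn : k + 1 ≤ n := by nlinarith
  have hn0 : (0 : ℝ) < n := by exact_mod_cast (Nat.succ_pos k).trans_le hkn
  have hrad : ((k + 1 : ℕ) : ℝ) * n / (k + 1 : ℕ) = n := by
    have : ((k + 1 : ℕ) : ℝ) ≠ 0 := by positivity
    field_simp
  rw [hrad] at ht hne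
  have hre := re_lt_of_norm_le ht hne
  have hC := measurable_minCost (le_refl (k + 1)) hkn
  -- With zeros in all rows the expectation is finite even at `n`; the summed identity transfers
  -- finiteness to the original costs for parameters below `n`.
  have hfin : ∫⁻ c, ENNReal.ofReal (Real.exp (max t.re 0 * minCost (k + 1) (k + 1) n c))
      ∂(expPi (Fin (k + 1) × Fin n)) < ∞ := by
    have hsum := sum_lintegral_zeroRows hkn Finset.univ (max_lt hre hn0)
    have htop : ENNReal.ofReal (n / (n - max t.re 0)) ^ (Finset.univ : Finset (Fin (k + 1))).card *
        ∑ j : Fin (k + 1) → Fin n, ∫⁻ c, ENNReal.ofReal (Real.exp (max t.re 0 *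
          minCost (k + 1) (k + 1) n (zeroRows Finset.univ j c)))
          ∂(expPi (Fin (k + 1) × Fin n)) < ∞ := by
      refine ENNReal.mul_lt_top (ENNReal.pow_lt_top ENNReal.ofReal_lt_top)
        (ENNReal.sum_lt_top.2 fun j _ => ?_)
      refine lt_of_le_of_lt (lintegral_mono_ae ?_) (norm_integral_zeroRows_sub_one_le hn j ht).1
      filter_upwards [ae_expPi_pos] with c hc
      exact ENNReal.ofReal_le_ofReal <| Real.exp_le_exp.2 <| mul_le_mul_of_nonneg_right
        (max_lt hre hn0).le (setMin_nonneg (zeroRows_nonneg _ j fun e => (hc e).le))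
    rw [← hsum] at htop
    exact ENNReal.sum_lt_top.1 htop (fun _ => ⟨0, (Nat.succ_pos k).trans_le hkn⟩)
      (Finset.mem_univ _)
  have hintR : ∀ (R : Finset (Fin (k + 1))) (j : Fin (k + 1) → Fin n), Integrable
      (fun c => Complex.exp (t * minCost (k + 1) (k + 1) n (zeroRows R j c)))
      (expPi (Fin (k + 1) × Fin n)) := by
    intro R j
    refine integrable_cexp_mul_of_re_le (hC.comp (measurable_zeroRows R j))
      (fun c hc => setMin_nonneg (zeroRows_nonneg R j hc)) (le_max_left _ 0)
      (lt_of_le_of_lt (lintegral_mono_ae ?_) hfin)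
    filter_upwards [ae_expPi_pos] with c hc
    exact ENNReal.ofReal_le_ofReal <| Real.exp_le_exp.2 <| mul_le_mul_of_nonneg_left
      (minCost_zeroRows_le_minCost hkn R j fun e => (hc e).le) (le_max_right _ _)
  refine ⟨integrable_cexp_mul_of_re_le hC (fun c hc => setMin_nonneg hc) (le_max_left _ 0) hfin,
    fun hzero => ?_⟩
  have hsum := sum_integral_zeroRows hkn Finset.univ hre hintR
  rw [complexMGF, costMeasure_eq] at hzero
  rw [hzero, Finset.sum_const_zero] at hsum
  have hfac : ((n : ℂ) / (n - t)) ≠ 0 := by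
    refine div_ne_zero (by exact_mod_cast hn0.ne') fun h => ?_
    have := congrArg Complex.re h
    simp at this
    linarith
  have hS := (mul_eq_zero.1 hsum.symm).resolve_left (pow_ne_zero _ hfac)
  have hdiff := Finset.sum_sub_distrib (s := (Finset.univ : Finset (Fin (k + 1) → Fin n)))
    (f := fun j => ∫ c, Complex.exp (t * minCost (k + 1) (k + 1) n (zeroRows Finset.univ j c))
      ∂(expPi (Fin (k + 1) × Fin n))) (g := fun _ => 1)
  rw [hS, zero_sub] at hdiff
  have hle := (norm_sum_le (Finset.univ : Finset (Fin (k + 1) → Fin n)) (fun j => ∫ c, Complex.exp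
    (t * minCost (k + 1) (k + 1) n (zeroRows Finset.univ j c))
      ∂(expPi (Fin (k + 1) × Fin n)) - 1)).trans
    (Finset.sum_le_sum fun j _ => (norm_integral_zeroRows_sub_one_le hn j ht).2)
  rw [hdiff, norm_neg, Finset.sum_ite, Finset.sum_const_zero, zero_add, Finset.sum_const,
    Finset.sum_const, Finset.card_univ, Fintype.card_fun, Fintype.card_fin, Fintype.card_fin] at hle
  simp only [nsmul_eq_mul, mul_one, Nat.cast_pow, norm_pow, Complex.norm_natCast] at hle
  -- If the sum were zero, the deviations from 1 would have to make up `n ^ (k + 1)`. The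
  -- non-injective functions give at most `(k + 1) ^ 2 * (2 * (k + 1)) ^ k * n ^ k`, too little by
  -- `hlarge`.
  have hcount := card_not_injective_le (k + 1) n hkn
  have hB : (0 : ℝ) < (2 * (k + 1)) ^ k := by positivity
  have hnk : (0 : ℝ) < (n : ℝ) ^ (k + 1) := by positivity
  have h1 := mul_le_mul_of_nonneg_right hle hn0.le
  have h2 := mul_le_mul_of_nonneg_right hcount hB.le
  have h3 := mul_lt_mul_of_pos_right hlarge hnk
  nlinarith

/-! ### Transposition, the point `m * n / k` and the conclusion -/

lemma NonvanishingMGF.swap {k m n : ℕ} (hm : k ≤ m) (hn : k ≤ n) (h : NonvanishingMGF k m n) :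
    NonvanishingMGF k n m := by
  intro t ht hne
  rw [mul_comm] at ht
  rw [mul_comm] at hne
  obtain ⟨hint, hval⟩ := h t ht hne
  have hσ : MeasurePreserving (fun c : Fin n × Fin m → ℝ => c ∘ Prod.swap) (costMeasure n m)
      (costMeasure m n) :=
    measurePreserving_expPi_comp (Prod.swap : Fin m × Fin n → Fin n × Fin m) Prod.swap_injective
  have hC := measurable_minCost hm hn
  have hf : Measurable fun c => Complex.exp (t * (minCost k m n c : ℂ)) := by fun_prop
  refine ⟨?_, ?_⟩
  · have h1 := (hσ.integrable_comp hf.aestronglyMeasurable).2 hint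
    simpa only [Function.comp_def, ← minCost_comp_swap k n m] using h1
  · have h1 : complexMGF (minCost k n m) (costMeasure n m) t =
        complexMGF (minCost k m n) (costMeasure m n) t := by
      rw [complexMGF, complexMGF, ← hσ.map_eq,
        integral_map hσ.aemeasurable hf.aestronglyMeasurable]
      simp only [minCost_comp_swap]
    rwa [h1]

lemma one_le_re_complexMGF {k m n : ℕ} {r : ℝ} (hr : 0 ≤ r)
    (hint : Integrable (fun c => Complex.exp ((r : ℂ) * (minCost k m n c : ℂ)))
      (costMeasure m n)) :
    1 ≤ (complexMGF (minCost k m n) (costMeasure m n) r).re := by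
  have h1 : ∀ c, Complex.exp ((r : ℂ) * (minCost k m n c : ℂ)) =
      ((Real.exp (r * minCost k m n c) : ℝ) : ℂ) := fun c => by push_cast; rfl
  have h2 : Integrable (fun c => Real.exp (r * minCost k m n c)) (costMeasure m n) := by
    refine hint.norm.congr (Filter.Eventually.of_forall fun c => ?_)
    simp only [h1, Complex.norm_real, Real.norm_eq_abs, Real.abs_exp]
  rw [complexMGF]
  simp_rw [h1]
  rw [integral_complex_ofReal, Complex.ofReal_re, costMeasure_eq]
  have h3 : ∫ _ : Fin m × Fin n → ℝ, (1 : ℝ) ∂(expPi (Fin m × Fin n)) = 1 := by simp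
  rw [← h3]
  refine integral_mono_ae (integrable_const _) h2 ?_
  filter_upwards [ae_expPi_pos] with c hc
  exact Real.one_le_exp (mul_nonneg hr (setMin_nonneg fun e => (hc e).le))

/-- At the point `m * n / k` of the circle of convergence the function has no zero, since it is
at least `1` on the segment from `0` to this point. -/
theorem not_isZeroOf {k m n : ℕ} (hk : 1 ≤ k) (hm : k ≤ m) (hn : k ≤ n) {F : RatFunc ℂ}
    (hF : IsMomentGeneratingFunction k m n F) (h : NonvanishingMGF k m n) {t : ℂ}
    (ht : ‖t‖ ≤ (m : ℝ) * n / k) : ¬ IsZeroOf F t := by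
  intro hzero
  by_cases hne : t = ((m * n / k : ℝ) : ℂ)
  · set ρ : ℝ := (m : ℝ) * n / k with hρ
    have hρ0 : 0 < ρ := by
      have : (0 : ℝ) < k := by exact_mod_cast hk
      have : (0 : ℝ) < m := by exact_mod_cast hk.trans hm
      have : (0 : ℝ) < n := by exact_mod_cast hk.trans hn
      positivity
    subst hne
    -- Numerator and denominator are coprime, so a zero of the numerator is not a pole and `F` is
    -- continuous there.
    have hden : F.denom.eval (ρ : ℂ) ≠ 0 := by
      intro h0
      obtain ⟨a, b, hab⟩ := RatFunc.isCoprime_num_denom F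
      have h1 := congrArg (Polynomial.eval (ρ : ℂ)) hab
      rw [IsZeroOf] at hzero
      simp [hzero, h0] at h1
    let f : ℝ → ℂ := fun r => F.num.eval (r : ℂ) / F.denom.eval (r : ℂ)
    have hcont : ContinuousAt f ρ := by
      refine ContinuousAt.div ?_ ?_ hden
      · exact (F.num.continuous.comp Complex.continuous_ofReal).continuousAt
      · exact (F.denom.continuous.comp Complex.continuous_ofReal).continuousAt
    have hfρ : f ρ = 0 := by
      simp only [f]
      rw [show F.num.eval (ρ : ℂ) = 0 from hzero, zero_div]
    have hge : ∀ r ∈ Set.Ioo 0 ρ, 1 ≤ (f r).re := by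
      intro r hr
      have hnorm : ‖(r : ℂ)‖ ≤ ρ := by
        rw [Complex.norm_real, Real.norm_of_nonneg hr.1.le]; exact hr.2.le
      obtain ⟨hint, -⟩ := h r hnorm fun h' => hr.2.ne (Complex.ofReal_injective h')
      have h1 := (hF r hint).2
      have h2 : f r = complexMGF (minCost k m n) (costMeasure m n) r := by
        rw [← h1, RatFunc.eval, Polynomial.eval₂_id, Polynomial.eval₂_id]
      rw [h2]
      exact one_le_re_complexMGF hr.1.le hint
    have hlim : Filter.Tendsto (fun r => (f r).re) (nhdsWithin ρ (Set.Iio ρ)) (nhds (f ρ).re) :=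
      (Complex.continuous_re.continuousAt.comp hcont).tendsto.mono_left nhdsWithin_le_nhds
    have hle := ge_of_tendsto hlim
      (Filter.mem_of_superset (Ioo_mem_nhdsLT hρ0) fun r hr => hge r hr)
    rw [hfρ, Complex.zero_re] at hle
    linarith
  · obtain ⟨hint, hval⟩ := h t ht hne
    have h1 := (hF t hint).2
    rw [RatFunc.eval, Polynomial.eval₂_id, Polynomial.eval₂_id,
      show F.num.eval t = 0 from hzero, zero_div] at h1
    exact hval h1.symm

theorem eventually_nonvanishingMGF (k : ℕ) (hk : 1 ≤ k) :
    ∀ᶠ n : ℕ in Filter.atTop, ∀ m, k ≤ m → NonvanishingMGF k m n := by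
  obtain ⟨k, rfl⟩ := Nat.exists_eq_add_of_le' hk
  -- The case with a spare row is stated for `n + 1` columns, hence the shift.
  have hlt := (Filter.tendsto_sub_atTop_nat 1).eventually (eventually_nonvanishingMGF_of_lt k)
  filter_upwards [hlt, eventually_nonvanishingMGF_self k, Filter.eventually_ge_atTop 1]
    with n h1 h2 hn m hm
  rcases hm.eq_or_lt with rfl | hm
  · exact h2
  · have := h1 (m - 1) (by omega)
    rwa [Nat.sub_add_cancel hn, Nat.sub_add_cancel (by omega)] at this

end BipartiteMatching

theorem propositionP (k : ℕ) (hk : 1 ≤ k) :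
    ∃ F : ℕ → ℕ → RatFunc ℂ,
      (∀ m n : ℕ, k ≤ m → k ≤ n →
        BipartiteMatching.IsMomentGeneratingFunction k m n (F m n)) ∧
      {p : ℕ × ℕ | k ≤ p.1 ∧ k ≤ p.2 ∧
        ∃ t : ℂ, ‖t‖ ≤ (p.1 : ℝ) * (p.2 : ℝ) / (k : ℝ) ∧
          BipartiteMatching.IsZeroOf (F p.1 p.2) t}.Finite := by
  have hex : ∀ m n : ℕ, ∃ F : RatFunc ℂ, k ≤ m → k ≤ n →
      BipartiteMatching.IsMomentGeneratingFunction k m n F := by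
    intro m n
    by_cases h : k ≤ m ∧ k ≤ n
    · obtain ⟨F, hF⟩ := BipartiteMatching.exists_isMomentGeneratingFunction h.1 h.2
      exact ⟨F, fun _ _ => hF⟩
    -- Outside the range `k ≤ m, n` nothing is required of the function.
    · exact ⟨0, fun hm hn => absurd ⟨hm, hn⟩ h⟩
  choose F hF using hex
  refine ⟨F, hF, ?_⟩
  obtain ⟨N, hN⟩ :=
    Filter.eventually_atTop.1 (BipartiteMatching.eventually_nonvanishingMGF k hk)
  refine ((Set.finite_lt_nat N).prod (Set.finite_lt_nat N)).subset ?_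
  rintro ⟨m, n⟩ ⟨hm, hn, t, ht, hzero⟩
  by_contra hlarge
  have hnv : BipartiteMatching.NonvanishingMGF k m n := by
    -- Outside the square of side `N` one dimension is at least `N`; if it is `m`, transposition
    -- makes it the number of columns.
    rcases lt_or_ge m N with h | h
    · exact hN n (by by_contra hlt; exact hlarge ⟨h, not_le.1 hlt⟩) m hm
    · exact (hN m h n hn).swap hn hm
  exact BipartiteMatching.not_isZeroOf hk hm hn (hF m n hm hn) hnv ht hzero
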